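/- Let $(\mathcal V,\otimes,I,s)$ be a symmetric closed monoidal category with all small limits and colimits, with coherence isomorphisms $a_{U,V,W}:U\otimes(V\otimes W)\to(U\otimes V)\otimes W$, $l_V:V\to I\otimes V$, $r_V:V\otimes I\to V$. A *skew monoidal category* $(\mathcal M,*,R,\gamma,\eta,\varepsilon)$ consists of a category, a functor $*:\mathcal M\times\mathcal M\to\mathcal M$, an object $R$ and natural transformations $\gamma_{L,M,N}:L*(M*N)\to(L*M)*N$, $\eta_M:M\to R*M$, $\varepsilon_M:M*R\to M$ (not necessarily invertible) with $(\gamma_{K,L,M}*N)\gamma_{K,L*M,N}(K*\gamma_{L,M,N})=\gamma_{K*L,M,N}\gamma_{K,L,M*N}$, $\gamma_{R,M,N}\eta_{M*N}=\eta_M*N$, $\varepsilon_{M*N}\gamma_{M,N,R}=M*\varepsilon_N$, $(\varepsilon_M*N)\gamma_{M,R,N}(M*\eta_N)=1$, $\varepsilon_R\eta_R=1$. A *skew monoidal functor* $(F,F_2,F_0):\mathcal M\to\mathcal M'$ is a functor $F$ with a natural transformation $F_{M,N}:FM*'FN\to F(M*N)$ and a morphism $F_0:R'\to FR$ satisfying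 $F\gamma_{L,M,N}\,F_{L,M*N}(FL*'F_{M,N})=F_{L*M,N}(F_{L,M}*'FN)\gamma'_{FL,FM,FN}$, $F_{R,M}(F_0*'FM)\eta'_{FM}=F\eta_M$ and $F\varepsilon_M\,F_{M,R}(FM*'F_0)=\varepsilon'_{FM}$; it is *strictly normal* if $F_0$ is an identity. A left $\mathcal V$-*actegory* is a category $\mathcal M$ with a functor $\odot:\mathcal V\times\mathcal M\to\mathcal M$ and natural coherent isomorphisms $a_{U,V,M}:U\odot(V\odot M)\to(U\otimes V)\odot M$, $l_M:M\to I\odot M$. A *morphism* of $\mathcal V$-actegories is a functor $F$ with a natural strength $F_{V,M}:V\odot FM\to F(V\odot M)$ satisfying $F_{V\otimes W,M}\,a_{V,W,FM}=Fa_{V,W,M}\,F_{V,W\odot M}(V\odot F_{W,M})$ and $F_{I,M}l_{FM}=Fl_M$; it is *strict* if the strength is an identity. A *skew monoidal $\mathcal V$-actegory* is a $\mathcal V$-actegory $\mathcal M$ with a skew monoidal structure and natural transformations $\Gamma_{V,M,N}:V\odot(M*N)\to(V\odot M)*N$, $\Gamma'_{V,M,N}:V\odot(M*N)\to M*(V\odot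 N)$ such that $\Gamma_{-,-,N}$ and $\Gamma'_{-,M,-}$ are strengths for $-*N$ and $M*-$, $$\Gamma'_{U,V\odot M,N}(U\odot\Gamma_{V,M,N})=\Gamma_{V,M,U\odot N}(V\odot\Gamma'_{U,M,N})\,a^{-1}_{V,U,M*N}(s_{U,V}\odot(M*N))\,a_{U,V,M*N},$$ and $\gamma$ (in each of its three variables), $\eta$ and $\varepsilon$ are compatible with the strengths. It is a *skew monoidal tensored $\mathcal V$-category* if each functor $-\odot M:\mathcal V\to\mathcal M$ has a right adjoint. The latter is *r2-exact* if $\mathcal M$ has reflexive coequalizers, all functors $V\odot-$ and $M*-$ preserve them, and $\Gamma'$ is an isomorphism. A *skew monoidal $\mathcal V$-functor* is a skew monoidal functor $F$ which is also a morphism of $\mathcal V$-actegories (equivalently, a $\mathcal V$-functor) such that $F_{M,N}$ is compatible with the strengths in both variables: $F\Gamma_{V,M,N}\circ F_{V,M*N}\circ(V\odot F_{M,N})=F_{V\odot M,N}\circ(F_{V,M}*'FN)\circ\Delta_{V,FM,FN}$ and $F\Gamma'_{V,M,N}\circ F_{V,M*N}\circ(V\odot F_{M,N})=F_{M,V\odot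 N}\circ(FM*'F_{V,N})\circ\Delta'_{V,FM,FN}$, where $\Delta,\Delta'$ are the strengths of the codomain. Put $\mu_{N,M}:=(\varepsilon_N*M)\gamma_{N,R,M}:N*(R*M)\to N*M$. For a skew monoidal category $\mathcal M$ let $\mathcal M^T$ be the Eilenberg–Moore category of the monad $T=(R*-,\mu_{R,-},\eta)$, and let $G:\mathcal M^T\to\mathcal M$ be the forgetful functor. **Theorem.** Let $\mathcal M$ be an r2-exact skew monoidal tensored $\mathcal V$-category. Then $\mathcal M^T$ is again an r2-exact skew monoidal tensored $\mathcal V$-category, and $G$ is a skew monoidal $\mathcal V$-functor which is strict as a morphism of $\mathcal V$-actegories and strictly normal as a skew monoidal functor. Here the structure on $\mathcal M^T$ is as follows. The action is $V\odot(M,\alpha)=(V\odot M,\ (V\odot\alpha)\circ\Gamma'^{-1}_{V,R,M})$; the skew unit is $(R,\varepsilon_R)$; for $T$-algebras $\mathbf N=(N,\beta)$ and $\mathbf M=(M,\alpha)$, the multiplicativity constraint $\pi:=G_{\mathbf N,\mathbf M}:N*M\to G(\mathbf N\,\hat\otimes\,\mathbf M)$ of $G$ is a coequalizer of the pair $\mu_{N,M},\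 N*\alpha:N*(R*M)\rightrightarrows N*M$, and the algebra structure $\psi$ of $\mathbf N\,\hat\otimes\,\mathbf M$ satisfies $\psi\circ(R*\pi)=\pi\circ(\beta*M)\circ\gamma_{R,N,M}$. -/

import Mathlib

open CategoryTheory CategoryTheory.Limits MonoidalCategory
open scoped MonoidalLeftAction

universe u v u₁ v₁ u₂ v₂

namespace SkewActegory

section Bifunctor

variable {M : Type u₁} [Category.{v₁} M]

/-- The value `X * Y` of a bifunctor `* : M × M → M`, given in curried form. -/
abbrev prod (t : M ⥤ M ⥤ M) (X Y : M) : M := (t.obj X).obj Y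

/-- The morphism `X * g`. -/
abbrev lact (t : M ⥤ M ⥤ M) (X : M) {Y Y' : M} (g : Y ⟶ Y') : prod t X Y ⟶ prod t X Y' :=
  (t.obj X).map g

/-- The morphism `f * Y`. -/
abbrev ract (t : M ⥤ M ⥤ M) {X X' : M} (f : X ⟶ X') (Y : M) : prod t X Y ⟶ prod t X' Y :=
  (t.map f).app Y

end Bifunctor

/-- A (right) skew monoidal structure on a category: a bifunctor `*`, an object `R` and
natural transformations `γ : L * (M * N) ⟶ (L * M) * N`, `η : M ⟶ R * M`, `ε : M * R ⟶ M`,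
not assumed invertible, satisfying the five axioms of a (right) skew monoidal category. -/
structure SkewMonoidal (M : Type u₁) [Category.{v₁} M] where
  /-- the skew tensor `*` -/
  tensor : M ⥤ M ⥤ M
  /-- the skew unit `R` -/
  unit : M
  γ (X Y Z : M) : prod tensor X (prod tensor Y Z) ⟶ prod tensor (prod tensor X Y) Z
  η (X : M) : X ⟶ prod tensor unit X
  ε (X : M) : prod tensor X unit ⟶ X
  γ_naturality₁ {X X' : M} (f : X ⟶ X') (Y Z : M) :
    ract tensor f (prod tensor Y Z) ≫ γ X' Y Z = γ X Y Z ≫ ract tensor (ract tensor f Y) Z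
  γ_naturality₂ (X : M) {Y Y' : M} (g : Y ⟶ Y') (Z : M) :
    lact tensor X (ract tensor g Z) ≫ γ X Y' Z = γ X Y Z ≫ ract tensor (lact tensor X g) Z
  γ_naturality₃ (X Y : M) {Z Z' : M} (h : Z ⟶ Z') :
    lact tensor X (lact tensor Y h) ≫ γ X Y Z' = γ X Y Z ≫ lact tensor (prod tensor X Y) h
  η_naturality {X X' : M} (f : X ⟶ X') : f ≫ η X' = η X ≫ lact tensor unit f
  ε_naturality {X X' : M} (f : X ⟶ X') : ract tensor f unit ≫ ε X' = ε X ≫ f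
  pentagon (W X Y Z : M) :
    lact tensor W (γ X Y Z) ≫ γ W (prod tensor X Y) Z ≫ ract tensor (γ W X Y) Z =
      γ W X (prod tensor Y Z) ≫ γ (prod tensor W X) Y Z
  η_γ (X Y : M) : η (prod tensor X Y) ≫ γ unit X Y = ract tensor (η X) Y
  γ_ε (X Y : M) : γ X Y unit ≫ ε (prod tensor X Y) = lact tensor X (ε Y)
  η_γ_ε (X Y : M) :
    lact tensor X (η Y) ≫ γ X unit Y ≫ ract tensor (ε X) Y = 𝟙 (prod tensor X Y)
  η_ε : η unit ≫ ε unit = 𝟙 unit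

namespace SkewMonoidal

variable {M : Type u₁} [Category.{v₁} M] (S : SkewMonoidal M)

/-- `μ_{N,M} = (ε_N * M) ∘ γ_{N,R,M} : N * (R * M) ⟶ N * M`. -/
def mu (N X : M) : prod S.tensor N (prod S.tensor S.unit X) ⟶ prod S.tensor N X :=
  S.γ N S.unit X ≫ ract S.tensor (S.ε N) X

lemma mu_naturality (N : M) {X Y : M} (f : X ⟶ Y) :
    lact S.tensor N (lact S.tensor S.unit f) ≫ S.mu N Y = S.mu N X ≫ lact S.tensor N f := by
  have h := (S.tensor.map (S.ε N)).naturality f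
  simp only [mu, ← Category.assoc, S.γ_naturality₃]
  simp only [Category.assoc, ract, lact] at h ⊢
  rw [h]

lemma mu_assoc (N X : M) :
    lact S.tensor N (S.mu S.unit X) ≫ S.mu N X =
      S.mu N (prod S.tensor S.unit X) ≫ S.mu N X := by
  have h1 := S.γ_naturality₂ N (S.ε S.unit) X
  have h2 := S.pentagon N S.unit S.unit X
  have h3 := S.γ_naturality₁ (S.ε N) S.unit X
  have h4 := S.γ_ε N S.unit
  have h5 := S.ε_naturality (S.ε N)
  simp only [mu, lact, ract, prod, Functor.map_comp, Category.assoc] at *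
  rw [reassoc_of% h1, reassoc_of% h3, ← reassoc_of% h2, ← h4]
  simp only [Functor.map_comp, NatTrans.comp_app, Category.assoc]
  simp only [← NatTrans.comp_app, ← Functor.map_comp, h5]

/-- The canonical monad `T = R * -` of a skew monoidal category, with unit `η` and
multiplication `μ_{R,M} = (ε_R * M) ∘ γ_{R,R,M}`. -/
def canonicalMonad : Monad M where
  toFunctor := S.tensor.obj S.unit
  η := { app := fun X => S.η X
         naturality := fun _ _ f => S.η_naturality f }
  μ := { app := fun X => S.mu S.unit X
         naturality := fun _ _ f => S.mu_naturality S.unit f }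
  assoc X := S.mu_assoc S.unit X
  left_unit X := by
    have h := S.η_γ S.unit X
    simp only [mu, ract, prod] at *
    erw [reassoc_of% h]
    rw [← NatTrans.comp_app, ← Functor.map_comp, S.η_ε]
    simp
  right_unit X := S.η_γ_ε S.unit X

/-- The category `M^T` of modules over the skew monoidal category `M`: the Eilenberg-Moore
category of the canonical monad. -/
abbrev Module : Type (max u₁ v₁) := S.canonicalMonad.Algebra

/-- The forgetful functor `G : M^T ⥤ M`. -/
abbrev forget : S.Module ⥤ M := S.canonicalMonad.forget

/-- The structure map `R * A ⟶ A` of a module. -/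
abbrev act (A : S.Module) : prod S.tensor S.unit A.A ⟶ A.A := A.a

/-- The module `(R, ε_R)`. -/
def unitModule : S.Module where
  A := S.unit
  a := S.ε S.unit
  unit := S.η_ε
  assoc := by
    have h1 := S.ε_naturality (S.ε S.unit)
    have h2 := S.γ_ε S.unit S.unit
    change S.mu S.unit S.unit ≫ _ = lact S.tensor S.unit (S.ε S.unit) ≫ _
    simp only [mu, Category.assoc]
    rw [h1, reassoc_of% h2]

end SkewMonoidal

/-- A skew monoidal functor `(F, F₂, F₀)` with underlying functor `F`. -/
structure SkewMonoidalFunctor {M : Type u₁} [Category.{v₁} M] {N : Type u₂} [Category.{v₂} N]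
    (S : SkewMonoidal M) (S' : SkewMonoidal N) (F : M ⥤ N) where
  /-- the multiplicativity constraint `F X * F Y ⟶ F (X * Y)` -/
  F₂ (X Y : M) : prod S'.tensor (F.obj X) (F.obj Y) ⟶ F.obj (prod S.tensor X Y)
  /-- the unit constraint `R' ⟶ F R` -/
  F₀ : S'.unit ⟶ F.obj S.unit
  F₂_naturality₁ {X X' : M} (f : X ⟶ X') (Y : M) :
    ract S'.tensor (F.map f) (F.obj Y) ≫ F₂ X' Y = F₂ X Y ≫ F.map (ract S.tensor f Y)
  F₂_naturality₂ (X : M) {Y Y' : M} (g : Y ⟶ Y') :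
    lact S'.tensor (F.obj X) (F.map g) ≫ F₂ X Y' = F₂ X Y ≫ F.map (lact S.tensor X g)
  map_γ (X Y Z : M) :
    lact S'.tensor (F.obj X) (F₂ Y Z) ≫ F₂ X (prod S.tensor Y Z) ≫ F.map (S.γ X Y Z) =
      S'.γ (F.obj X) (F.obj Y) (F.obj Z) ≫ ract S'.tensor (F₂ X Y) (F.obj Z) ≫
        F₂ (prod S.tensor X Y) Z
  map_η (X : M) :
    S'.η (F.obj X) ≫ ract S'.tensor F₀ (F.obj X) ≫ F₂ S.unit X = F.map (S.η X)
  map_ε (X : M) :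
    lact S'.tensor (F.obj X) F₀ ≫ F₂ X S.unit ≫ F.map (S.ε X) = S'.ε (F.obj X)

/-- A skew monoidal functor is strictly normal if its unit constraint is an identity. -/
def SkewMonoidalFunctor.IsStrictlyNormal {M : Type u₁} [Category.{v₁} M] {N : Type u₂}
    [Category.{v₂} N] {S : SkewMonoidal M} {S' : SkewMonoidal N} {F : M ⥤ N}
    (K : SkewMonoidalFunctor S S' F) : Prop :=
  ∃ h : S'.unit = F.obj S.unit, K.F₀ = eqToHom h

section Actegory

variable (V : Type u) [Category.{v} V] [MonoidalCategory V] [SymmetricCategory V]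

/-- A skew monoidal structure on a left `V`-actegory `M`. The skew tensor is a two-variable
morphism of actegories, with strengths `Γ` (first variable) and `Γ'` (second variable), and
`γ`, `η`, `ε` are transformations of actegory morphisms. The isomorphism written
`U ⊙ (V ⊙ M) ≅ (U ⊗ V) ⊙ M` in the skew convention is the inverse of `αₗ U V M`, and
`M ≅ I ⊙ M` is the inverse of `λₗ M`. -/
structure SkewMonoidalActegory (M : Type u₁) [Category.{v₁} M] [MonoidalLeftAction V M]
    extends SkewMonoidal M where
  Γ (A : V) (X Y : M) : A ⊙ₗ prod tensor X Y ⟶ prod tensor (A ⊙ₗ X) Y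
  Γ' (A : V) (X Y : M) : A ⊙ₗ prod tensor X Y ⟶ prod tensor X (A ⊙ₗ Y)
  Γ_naturality₀ {A B : V} (a : A ⟶ B) (X Y : M) :
    a ⊵ₗ prod tensor X Y ≫ Γ B X Y = Γ A X Y ≫ ract tensor (a ⊵ₗ X) Y
  Γ_naturality₁ (A : V) {X X' : M} (f : X ⟶ X') (Y : M) :
    A ⊴ₗ ract tensor f Y ≫ Γ A X' Y = Γ A X Y ≫ ract tensor (A ⊴ₗ f) Y
  Γ_naturality₂ (A : V) (X : M) {Y Y' : M} (g : Y ⟶ Y') :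
    A ⊴ₗ lact tensor X g ≫ Γ A X Y' = Γ A X Y ≫ lact tensor (A ⊙ₗ X) g
  Γ'_naturality₀ {A B : V} (a : A ⟶ B) (X Y : M) :
    a ⊵ₗ prod tensor X Y ≫ Γ' B X Y = Γ' A X Y ≫ lact tensor X (a ⊵ₗ Y)
  Γ'_naturality₁ (A : V) {X X' : M} (f : X ⟶ X') (Y : M) :
    A ⊴ₗ ract tensor f Y ≫ Γ' A X' Y = Γ' A X Y ≫ ract tensor f (A ⊙ₗ Y)
  Γ'_naturality₂ (A : V) (X : M) {Y Y' : M} (g : Y ⟶ Y') :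
    A ⊴ₗ lact tensor X g ≫ Γ' A X Y' = Γ' A X Y ≫ lact tensor X (A ⊴ₗ g)
  Γ_assoc (A B : V) (X Y : M) :
    (αₗ A B (prod tensor X Y)).inv ≫ Γ (A ⊗ B) X Y =
      A ⊴ₗ Γ B X Y ≫ Γ A (B ⊙ₗ X) Y ≫ ract tensor (αₗ A B X).inv Y
  Γ_unit (X Y : M) :
    (λₗ[V] (prod tensor X Y)).inv ≫ Γ (𝟙_ V) X Y = ract tensor (λₗ[V] X).inv Y
  Γ'_assoc (A B : V) (X Y : M) :
    (αₗ A B (prod tensor X Y)).inv ≫ Γ' (A ⊗ B) X Y =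
      A ⊴ₗ Γ' B X Y ≫ Γ' A X (B ⊙ₗ Y) ≫ lact tensor X (αₗ A B Y).inv
  Γ'_unit (X Y : M) :
    (λₗ[V] (prod tensor X Y)).inv ≫ Γ' (𝟙_ V) X Y = lact tensor X (λₗ[V] Y).inv
  Γ_Γ' (A B : V) (X Y : M) :
    A ⊴ₗ Γ B X Y ≫ Γ' A (B ⊙ₗ X) Y =
      (αₗ A B (prod tensor X Y)).inv ≫ (β_ A B).hom ⊵ₗ prod tensor X Y ≫
        (αₗ B A (prod tensor X Y)).hom ≫ B ⊴ₗ Γ' A X Y ≫ Γ B X (A ⊙ₗ Y)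
  γ_strength₁ (A : V) (X Y Z : M) :
    Γ A X (prod tensor Y Z) ≫ γ (A ⊙ₗ X) Y Z =
      A ⊴ₗ γ X Y Z ≫ Γ A (prod tensor X Y) Z ≫ ract tensor (Γ A X Y) Z
  γ_strength₂ (A : V) (X Y Z : M) :
    Γ' A X (prod tensor Y Z) ≫ lact tensor X (Γ A Y Z) ≫ γ X (A ⊙ₗ Y) Z =
      A ⊴ₗ γ X Y Z ≫ Γ A (prod tensor X Y) Z ≫ ract tensor (Γ' A X Y) Z
  γ_strength₃ (A : V) (X Y Z : M) :
    Γ' A X (prod tensor Y Z) ≫ lact tensor X (Γ' A Y Z) ≫ γ X Y (A ⊙ₗ Z) =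
      A ⊴ₗ γ X Y Z ≫ Γ' A (prod tensor X Y) Z
  η_strength (A : V) (X : M) : A ⊴ₗ η X ≫ Γ' A unit X = η (A ⊙ₗ X)
  ε_strength (A : V) (X : M) : Γ A X unit ≫ ε (A ⊙ₗ X) = A ⊴ₗ ε X

namespace SkewMonoidalActegory

variable {V} {M : Type u₁} [Category.{v₁} M] [MonoidalLeftAction V M]

/-- A skew monoidal `V`-actegory is a skew monoidal tensored `V`-category (equivalently, it is
hommed) if every functor `- ⊙ X : V ⥤ M` has a right adjoint. -/
def IsTensored (_S : SkewMonoidalActegory V M) : Prop :=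
  ∀ X : M, (MonoidalLeftAction.actionRight V X).IsLeftAdjoint

/-- The exactness conditions that make a skew monoidal tensored `V`-category r2-exact. -/
structure IsR2Exact (S : SkewMonoidalActegory V M) : Prop where
  hasReflexiveCoequalizers : HasReflexiveCoequalizers M
  action_preserves (A : V) :
    Monad.PreservesColimitOfIsReflexivePair (MonoidalLeftAction.actionLeft M A)
  strong (A : V) (X Y : M) : IsIso (S.Γ' A X Y)
  tensor_preserves (X : M) : Monad.PreservesColimitOfIsReflexivePair (S.tensor.obj X)

end SkewMonoidalActegory

variable {V}

/-- A skew monoidal `V`-functor with underlying functor `F`: a skew monoidal functor, together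
with a strength `A ⊙ F X ⟶ F (A ⊙ X)` making `F` a morphism of `V`-actegories (a `V`-functor),
such that the multiplicativity constraint is `V`-natural in both variables. -/
structure SkewMonoidalVFunctor {M : Type u₁} [Category.{v₁} M] [MonoidalLeftAction V M]
    {N : Type u₂} [Category.{v₂} N] [MonoidalLeftAction V N]
    (S : SkewMonoidalActegory V M) (S' : SkewMonoidalActegory V N) (F : M ⥤ N)
    extends SkewMonoidalFunctor S.toSkewMonoidal S'.toSkewMonoidal F where
  [strength : F.LaxLeftLinear V]
  F₂_strength₁ (A : V) (X Y : M) :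
    A ⊴ₗ F₂ X Y ≫ Functor.LaxLeftLinear.μₗ F A (prod S.tensor X Y) ≫ F.map (S.Γ A X Y) =
      S'.Γ A (F.obj X) (F.obj Y) ≫
        ract S'.tensor (Functor.LaxLeftLinear.μₗ F A X) (F.obj Y) ≫ F₂ (A ⊙ₗ X) Y
  F₂_strength₂ (A : V) (X Y : M) :
    A ⊴ₗ F₂ X Y ≫ Functor.LaxLeftLinear.μₗ F A (prod S.tensor X Y) ≫ F.map (S.Γ' A X Y) =
      S'.Γ' A (F.obj X) (F.obj Y) ≫
        lact S'.tensor (F.obj X) (Functor.LaxLeftLinear.μₗ F A Y) ≫ F₂ X (A ⊙ₗ Y)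

/-- A morphism of actegories is strict if its strength is the identity. -/
def IsStrict {M : Type u₁} [Category.{v₁} M] [MonoidalLeftAction V M]
    {N : Type u₂} [Category.{v₂} N] [MonoidalLeftAction V N]
    (F : M ⥤ N) (s : F.LaxLeftLinear V) : Prop :=
  ∀ (A : V) (X : M), ∃ h : A ⊙ₗ F.obj X = F.obj (A ⊙ₗ X), s.μₗ A X = eqToHom h

end Actegory

end SkewActegory

/-! A `T`-algebra is a module over `R`, and the tensor product of `N` with a module `X` is balanced
over `R`: it is the coequalizer `Q N X` of `μ` and `N * α`, with quotient map `π`. It depends only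
on the object `N`; an action on `N` enters only to make `Q N X` a module, through `ψ`.

The defining pair is reflexive, so `L * -` and `A ⊙ -` preserve its coequalizer. Hence morphisms out
of `L * Q N X` or `A ⊙ Q N X` can be defined before passing to the quotient, and iterated
whiskerings of `π` on the left are epimorphisms. Each constraint of `M^T` is the one of `M` followed
by quotient maps (`γQ`, `ηQ`, `εQ`, `ΓQ`, `ΓQ'`), and each axiom becomes the same axiom of `M` once
such epimorphisms are cancelled. The direction of `γ` suits this: `π * X` occurs only on the target
side, so nothing is asked of the functors `- * X`.

Invertibility of `Γ'` makes `A ⊙ X` a module. It also identifies the pair defining `Q N (A ⊙ X)`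
with `A ⊙ -` applied to the pair defining `Q N X`, so `ΓQ'` is invertible again. Reflexive
coequalizers are created by `G` because `R * -` preserves them, and `Q N` preserves them because
colimits commute with colimits (`isColimitQl`). Finally, the hom object of two modules is an
equalizer in `V` of hom objects of `M` (`moduleHomEquiv`). -/

namespace SkewActegory

/-! ### Whiskering calculus for the skew tensor. -/

section Bifunctor

variable {M : Type u₁} [Category.{v₁} M] (t : M ⥤ M ⥤ M)

lemma lact_id (X Y : M) : lact t X (𝟙 Y) = 𝟙 (prod t X Y) := (t.obj X).map_id Y

lemma ract_id (X Y : M) : ract t (𝟙 X) Y = 𝟙 (prod t X Y) := by simp [ract]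

lemma lact_comp (X : M) {Y Y' Y'' : M} (f : Y ⟶ Y') (g : Y' ⟶ Y'') :
    lact t X (f ≫ g) = lact t X f ≫ lact t X g := (t.obj X).map_comp f g

lemma ract_comp {X X' X'' : M} (f : X ⟶ X') (g : X' ⟶ X'') (Y : M) :
    ract t (f ≫ g) Y = ract t f Y ≫ ract t g Y := by simp [ract]

lemma lact_ract {X X' Y Y' : M} (f : X ⟶ X') (g : Y ⟶ Y') :
    lact t X g ≫ ract t f Y' = ract t f Y ≫ lact t X' g := (t.map f).naturality g

lemma lact_square (X : M) {Y₁ Y₂ Y₃ Y₄ : M} {f : Y₁ ⟶ Y₂} {g : Y₂ ⟶ Y₄} {f' : Y₁ ⟶ Y₃}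
    {g' : Y₃ ⟶ Y₄} (h : f ≫ g = f' ≫ g') :
    lact t X f ≫ lact t X g = lact t X f' ≫ lact t X g' := by
  rw [← lact_comp, h, lact_comp]

lemma ract_square {Y₁ Y₂ Y₃ Y₄ : M} {f : Y₁ ⟶ Y₂} {g : Y₂ ⟶ Y₄} {f' : Y₁ ⟶ Y₃}
    {g' : Y₃ ⟶ Y₄} (h : f ≫ g = f' ≫ g') (X : M) :
    ract t f X ≫ ract t g X = ract t f' X ≫ ract t g' X := by
  rw [← ract_comp, h, ract_comp]

end Bifunctor

/-! ### Identities for `μ` and modules in terms of the skew monoidal operations. -/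

namespace SkewMonoidal

variable {M : Type u₁} [Category.{v₁} M] (S : SkewMonoidal M)

lemma lact_η_mu (N X : M) : lact S.tensor N (S.η X) ≫ S.mu N X = 𝟙 _ := S.η_γ_ε N X

/-- The multiplication `μ_{N,M}` is compatible with `γ`. -/
lemma γ_mu (L N X : M) :
    lact S.tensor L (S.mu N X) ≫ S.γ L N X =
      S.γ L N (prod S.tensor S.unit X) ≫ S.mu (prod S.tensor L N) X := by
  simp only [mu, lact_comp, Category.assoc]
  rw [S.γ_naturality₂, ← S.γ_ε, ract_comp, reassoc_of% S.pentagon]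

/-- The two ways of multiplying a copy of the unit in the middle of a triple product. -/
lemma mu_γ (L N X : M) :
    S.mu L (prod S.tensor N X) ≫ S.γ L N X =
      lact S.tensor L (S.γ S.unit N X) ≫ S.γ L (prod S.tensor S.unit N) X ≫
        ract S.tensor (S.mu L N) X := by
  simp only [mu, ract_comp, Category.assoc]
  rw [S.γ_naturality₁, reassoc_of% S.pentagon]

lemma mu_ract {N N' : M} (f : N ⟶ N') (X : M) :
    ract S.tensor f (prod S.tensor S.unit X) ≫ S.mu N' X = S.mu N X ≫ ract S.tensor f X := by
  simp only [mu, Category.assoc]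
  rw [reassoc_of% S.γ_naturality₁, ← ract_comp, S.ε_naturality, ract_comp]

/-- This is the condition under which `ε_N` factors through the quotient `Q N (R, ε_R)`. -/
lemma mu_ε (N : M) : S.mu N S.unit ≫ S.ε N = lact S.tensor N (S.ε S.unit) ≫ S.ε N := by
  rw [mu, Category.assoc, S.ε_naturality, reassoc_of% S.γ_ε]

lemma act_unit (A : S.Module) : S.η A.A ≫ S.act A = 𝟙 A.A := A.unit

lemma act_assoc (A : S.Module) :
    S.mu S.unit A.A ≫ S.act A = lact S.tensor S.unit (S.act A) ≫ S.act A := A.assoc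

lemma hom_act {A B : S.Module} (f : A ⟶ B) :
    lact S.tensor S.unit f.f ≫ S.act B = S.act A ≫ f.f := f.h

/-- A module, presented by the operations of the skew monoidal category. -/
abbrev mkModule (X : M) (a : prod S.tensor S.unit X ⟶ X) (unit : S.η X ≫ a = 𝟙 X)
    (assoc : S.mu S.unit X ≫ a = lact S.tensor S.unit a ≫ a) : S.Module where
  A := X
  a := a
  unit := unit
  assoc := assoc

variable {S} in
/-- A morphism of modules, presented by the operations of the skew monoidal category. -/
abbrev mkHom {A B : S.Module} (f : A.A ⟶ B.A)
    (h : lact S.tensor S.unit f ≫ S.act B = S.act A ≫ f) : A ⟶ B where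
  f := f
  h := h

/-- The module `(R, ε_R)`, in a form in which its underlying object unfolds to `R`. -/
abbrev unitObj : S.Module := S.mkModule S.unit (S.ε S.unit) S.η_ε S.unitModule.assoc

/-- The common section is `N * η`: it splits `μ` by the triangle axiom relating `η`, `γ` and `ε`,
and it splits `N * α` by the unit law of the module. -/
instance isReflexivePair_mu_act (N : M) (X : S.Module) :
    IsReflexivePair (S.mu N X.A) (lact S.tensor N (S.act X)) :=
  IsReflexivePair.mk' (lact S.tensor N (S.η X.A)) (S.lact_η_mu N X.A) (by
    rw [← lact_comp, S.act_unit, lact_id])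

end SkewMonoidal

/-! ### Reflexive pairs and their quotients under functors. -/

section ReflexivePairs

variable {C : Type u₁} [Category.{v₁} C] {D : Type u₂} [Category.{v₁} D]

lemma isReflexivePair_map (F : C ⥤ D) {X Y : C} (f g : X ⟶ Y) [IsReflexivePair f g] :
    IsReflexivePair (F.map f) (F.map g) :=
  IsReflexivePair.mk' (F.map (commonSection f g))
    (by rw [← F.map_comp, section_comp_left, F.map_id])
    (by rw [← F.map_comp, section_comp_right, F.map_id])

/-- A coequalizer of a reflexive pair. -/
def IsReflexiveQuotient {X Y : C} (q : X ⟶ Y) : Prop :=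
  ∃ (W : C) (f g : W ⟶ X) (_ : IsReflexivePair f g) (w : f ≫ q = g ≫ q),
    Nonempty (IsColimit (Cofork.ofπ q w))

lemma IsReflexiveQuotient.epi {X Y : C} {q : X ⟶ Y} (h : IsReflexiveQuotient q) : Epi q := by
  obtain ⟨W, f, g, _, w, ⟨l⟩⟩ := h
  exact Cofork.IsColimit.epi l

/-- The functors at hand need not preserve arbitrary epimorphisms. Being a reflexive quotient is
stable under them and can be iterated, which is how whiskerings of `π` are shown to be epimorphisms.
-/
lemma IsReflexiveQuotient.map {X Y : C} {q : X ⟶ Y} (h : IsReflexiveQuotient q) (F : C ⥤ D)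
    (hF : Monad.PreservesColimitOfIsReflexivePair F) : IsReflexiveQuotient (F.map q) := by
  obtain ⟨W, f, g, _, w, ⟨l⟩⟩ := h
  exact ⟨_, F.map f, F.map g, isReflexivePair_map F f g, by rw [← F.map_comp, w, F.map_comp],
    ⟨isColimitCoforkMapOfIsColimit F w l⟩⟩

/-- Creation of colimits by a monadic functor concerns diagrams of the form `parallelPair f g ⋙ F`,
which are only isomorphic to parallel pairs. -/
lemma preservesColimit_parallelPair_comp {E : Type*} [Category.{v₁} E] (F : C ⥤ D) (G : D ⥤ E)
    (hG : Monad.PreservesColimitOfIsReflexivePair G) {X Y : C} (f g : X ⟶ Y)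
    [IsReflexivePair f g] : PreservesColimit (parallelPair f g ⋙ F) G :=
  have := isReflexivePair_map F f g
  have := hG.out (F.map f) (F.map g)
  preservesColimit_of_iso_diagram G (K₁ := parallelPair (F.map f) (F.map g))
    (diagramIsoParallelPair (parallelPair f g ⋙ F)).symm

end ReflexivePairs

end SkewActegory

noncomputable section

namespace SkewActegory

namespace SkewMonoidalActegory

variable {V : Type u} [Category.{v} V] [MonoidalCategory V] [SymmetricCategory V]
variable {M : Type u₁} [Category.{v₁} M] [MonoidalLeftAction V M]
variable (S : SkewMonoidalActegory V M)

/-! ### The balanced tensor product of an object with a module, and its module structure. -/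

section Quotient

variable [hE : Fact S.IsR2Exact]

instance hasCoequalizer_mu_act (N : M) (X : S.Module) :
    HasCoequalizer (S.mu N X.A) (lact S.tensor N (S.act X)) :=
  hE.out.hasReflexiveCoequalizers.has_coeq _ _

/-- The tensor product of an object `N` with a module `X` over the canonical monad: the
coequalizer of `μ_{N,X}` and `N * α`. -/
def Q (N : M) (X : S.Module) : M := coequalizer (S.mu N X.A) (lact S.tensor N (S.act X))

/-- The quotient map `N * X ⟶ Q N X`. -/
def π (N : M) (X : S.Module) : prod S.tensor N X.A ⟶ S.Q N X := coequalizer.π _ _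

lemma π_condition (N : M) (X : S.Module) :
    S.mu N X.A ≫ S.π N X = lact S.tensor N (S.act X) ≫ S.π N X := coequalizer.condition _ _

/-- `π` is a coequalizer. -/
def isColimitπ (N : M) (X : S.Module) : IsColimit (Cofork.ofπ (S.π N X) (S.π_condition N X)) :=
  coequalizerIsCoequalizer _ _

lemma isReflexiveQuotient_π (N : M) (X : S.Module) : IsReflexiveQuotient (S.π N X) :=
  ⟨_, _, _, inferInstance, S.π_condition N X, ⟨S.isColimitπ N X⟩⟩

lemma isReflexiveQuotient_lact {X Y : M} {q : X ⟶ Y} (h : IsReflexiveQuotient q) (L : M) :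
    IsReflexiveQuotient (lact S.tensor L q) :=
  h.map _ (hE.out.tensor_preserves L)

lemma isReflexiveQuotient_action (S : SkewMonoidalActegory V M) [hE : Fact S.IsR2Exact] {X Y : M}
    {q : X ⟶ Y} (h : IsReflexiveQuotient q) (A : V) : IsReflexiveQuotient (A ⊴ₗ q) :=
  h.map (MonoidalLeftAction.actionLeft M A) (hE.out.action_preserves A)

instance epi_π (N : M) (X : S.Module) : Epi (S.π N X) := (S.isReflexiveQuotient_π N X).epi

instance epi_lact_π (L N : M) (X : S.Module) : Epi (lact S.tensor L (S.π N X)) :=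
  (S.isReflexiveQuotient_lact (S.isReflexiveQuotient_π N X) L).epi

instance epi_lact_lact_π (K L N : M) (X : S.Module) :
    Epi (lact S.tensor K (lact S.tensor L (S.π N X))) :=
  (S.isReflexiveQuotient_lact (S.isReflexiveQuotient_lact (S.isReflexiveQuotient_π N X) L) K).epi

instance epi_action_π (A : V) (N : M) (X : S.Module) : Epi (A ⊴ₗ S.π N X) :=
  (S.isReflexiveQuotient_action (S.isReflexiveQuotient_π N X) A).epi

instance epi_action_action_π (A B : V) (N : M) (X : S.Module) : Epi (A ⊴ₗ B ⊴ₗ S.π N X) :=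
  (S.isReflexiveQuotient_action (S.isReflexiveQuotient_action (S.isReflexiveQuotient_π N X) B)
    A).epi

instance epi_action_lact_π (A : V) (L N : M) (X : S.Module) :
    Epi (A ⊴ₗ lact S.tensor L (S.π N X)) :=
  (S.isReflexiveQuotient_action (S.isReflexiveQuotient_lact (S.isReflexiveQuotient_π N X) L)
    A).epi

section Descent

variable {S}
variable {N : M} {X : S.Module} {Z : M}

/-- The universal property of `Q N X`. -/
def desc (h : prod S.tensor N X.A ⟶ Z) (w : S.mu N X.A ≫ h = lact S.tensor N (S.act X) ≫ h) :
    S.Q N X ⟶ Z := coequalizer.desc h w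

lemma π_desc (h : prod S.tensor N X.A ⟶ Z)
    (w : S.mu N X.A ≫ h = lact S.tensor N (S.act X) ≫ h) : S.π N X ≫ desc h w = h :=
  coequalizer.π_desc h w

/-- The functor `F` preserves the quotient map `π`. -/
def isColimitMapπ (F : M ⥤ M) (hF : Monad.PreservesColimitOfIsReflexivePair F) (N : M)
    (X : S.Module) :
    IsColimit (Cofork.ofπ (F.map (S.π N X)) (by rw [← F.map_comp, S.π_condition, F.map_comp]) :
      Cofork (F.map (S.mu N X.A)) (F.map (lact S.tensor N (S.act X)))) :=
  isColimitCoforkMapOfIsColimit F _ (S.isColimitπ N X)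

/-- The universal property of `L * Q N X`. -/
def lactDesc {L : M} (h : prod S.tensor L (prod S.tensor N X.A) ⟶ Z)
    (w : lact S.tensor L (S.mu N X.A) ≫ h =
      lact S.tensor L (lact S.tensor N (S.act X)) ≫ h) : prod S.tensor L (S.Q N X) ⟶ Z :=
  Cofork.IsColimit.desc (isColimitMapπ (S.tensor.obj L) (hE.out.tensor_preserves L) N X) h w

lemma lact_π_lactDesc {L : M} (h : prod S.tensor L (prod S.tensor N X.A) ⟶ Z)
    (w : lact S.tensor L (S.mu N X.A) ≫ h =
      lact S.tensor L (lact S.tensor N (S.act X)) ≫ h) :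
    lact S.tensor L (S.π N X) ≫ lactDesc h w = h :=
  Cofork.IsColimit.π_desc' (isColimitMapπ (S.tensor.obj L) (hE.out.tensor_preserves L) N X) h w

/-- The universal property of `A ⊙ Q N X`. -/
def actionDesc {A : V} (h : A ⊙ₗ prod S.tensor N X.A ⟶ Z)
    (w : A ⊴ₗ S.mu N X.A ≫ h = A ⊴ₗ lact S.tensor N (S.act X) ≫ h) : A ⊙ₗ S.Q N X ⟶ Z :=
  Cofork.IsColimit.desc
    (isColimitMapπ (MonoidalLeftAction.actionLeft M A) (hE.out.action_preserves A) N X) h w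

lemma action_π_actionDesc {A : V} (h : A ⊙ₗ prod S.tensor N X.A ⟶ Z)
    (w : A ⊴ₗ S.mu N X.A ≫ h = A ⊴ₗ lact S.tensor N (S.act X) ≫ h) :
    A ⊴ₗ S.π N X ≫ actionDesc h w = h :=
  Cofork.IsColimit.π_desc'
    (isColimitMapπ (MonoidalLeftAction.actionLeft M A) (hE.out.action_preserves A) N X) h w

end Descent

/-- The functoriality of `Q` in the object variable. -/
def Qr {N N' : M} (f : N ⟶ N') (X : S.Module) : S.Q N X ⟶ S.Q N' X :=
  desc (ract S.tensor f X.A ≫ S.π N' X) (by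
    rw [← reassoc_of% S.mu_ract, S.π_condition, reassoc_of% lact_ract])

lemma π_Qr {N N' : M} (f : N ⟶ N') (X : S.Module) :
    S.π N X ≫ S.Qr f X = ract S.tensor f X.A ≫ S.π N' X := π_desc _ _

/-- The functoriality of `Q` in the module variable. -/
def Ql (N : M) {X X' : S.Module} (g : X ⟶ X') : S.Q N X ⟶ S.Q N X' :=
  desc (lact S.tensor N g.f ≫ S.π N X') (by
    rw [← reassoc_of% S.mu_naturality, S.π_condition, ← Category.assoc, ← lact_comp, S.hom_act,
      lact_comp, Category.assoc])

lemma π_Ql (N : M) {X X' : S.Module} (g : X ⟶ X') :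
    S.π N X ≫ S.Ql N g = lact S.tensor N g.f ≫ S.π N X' := π_desc _ _

/-- The canonical morphism `L * Q N X ⟶ Q (L * N) X` induced by `γ`. -/
def Qγ (L N : M) (X : S.Module) : prod S.tensor L (S.Q N X) ⟶ S.Q (prod S.tensor L N) X :=
  lactDesc (S.γ L N X.A ≫ S.π _ X) (by
    rw [reassoc_of% S.γ_mu, S.π_condition, reassoc_of% S.γ_naturality₃])

lemma lact_π_Qγ (L N : M) (X : S.Module) :
    lact S.tensor L (S.π N X) ≫ S.Qγ L N X = S.γ L N X.A ≫ S.π _ X := lact_π_lactDesc _ _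

/-- The structure map of the tensor product of modules. -/
def ψ (N X : S.Module) : prod S.tensor S.unit (S.Q N.A X) ⟶ S.Q N.A X :=
  S.Qγ S.unit N.A X ≫ S.Qr (S.act N) X

lemma lact_π_ψ (N X : S.Module) :
    lact S.tensor S.unit (S.π N.A X) ≫ S.ψ N X =
      S.γ S.unit N.A X.A ≫ ract S.tensor (S.act N) X.A ≫ S.π N.A X := by
  rw [ψ, reassoc_of% S.lact_π_Qγ, S.π_Qr]

lemma η_ψ (N X : S.Module) : S.η (S.Q N.A X) ≫ S.ψ N X = 𝟙 _ := by
  rw [← cancel_epi (S.π N.A X), reassoc_of% S.η_naturality, S.lact_π_ψ, reassoc_of% S.η_γ,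
    ← Category.assoc, ← ract_comp, S.act_unit, ract_id, Category.id_comp, Category.comp_id]

/-- On `R * (R * (N * X))` the compatibility `mu_γ` of `μ` with `γ` moves the multiplication onto
the factor `N`, where it is the associativity of the action on `N`. -/
lemma mu_ψ (N X : S.Module) :
    S.mu S.unit (S.Q N.A X) ≫ S.ψ N X = lact S.tensor S.unit (S.ψ N X) ≫ S.ψ N X := by
  rw [← cancel_epi (lact S.tensor S.unit (lact S.tensor S.unit (S.π N.A X))),
    reassoc_of% S.mu_naturality, S.lact_π_ψ,
    reassoc_of% lact_square _ _ (S.lact_π_ψ N X), lact_comp, Category.assoc, S.lact_π_ψ,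
    reassoc_of% S.mu_γ, reassoc_of% S.γ_naturality₂,
    reassoc_of% ract_square _ (S.act_assoc N) X.A]

/-- The tensor product of modules. -/
abbrev tensorObj (N X : S.Module) : S.Module :=
  S.mkModule (S.Q N.A X) (S.ψ N X) (S.η_ψ N X) (S.mu_ψ N X)

lemma lact_π_act (N X : S.Module) :
    lact S.tensor S.unit (S.π N.A X) ≫ S.act (S.tensorObj N X) =
      S.γ S.unit N.A X.A ≫ ract S.tensor (S.act N) X.A ≫ S.π N.A X := S.lact_π_ψ N X

end Quotient

/-! ### The skew monoidal category of modules. -/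

lemma comp_f {A B C : S.Module} (f : A ⟶ B) (g : B ⟶ C) : (f ≫ g).f = f.f ≫ g.f := rfl

lemma id_f (A : S.Module) : (𝟙 A : A ⟶ A).f = 𝟙 A.A := rfl

variable [hE : Fact S.IsR2Exact]

lemma Qr_hom {N N' : S.Module} (f : N ⟶ N') (X : S.Module) :
    lact S.tensor S.unit (S.Qr f.f X) ≫ S.ψ N' X = S.ψ N X ≫ S.Qr f.f X := by
  rw [← cancel_epi (lact S.tensor S.unit (S.π N.A X)),
    reassoc_of% lact_square _ _ (S.π_Qr f.f X), S.lact_π_ψ, reassoc_of% S.lact_π_ψ, S.π_Qr,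
    reassoc_of% S.γ_naturality₂, reassoc_of% ract_square _ (S.hom_act f) X.A]

lemma Ql_hom (N : S.Module) {X X' : S.Module} (g : X ⟶ X') :
    lact S.tensor S.unit (S.Ql N.A g) ≫ S.ψ N X' = S.ψ N X ≫ S.Ql N.A g := by
  rw [← cancel_epi (lact S.tensor S.unit (S.π N.A X)),
    reassoc_of% lact_square _ _ (S.π_Ql N.A g), S.lact_π_ψ, reassoc_of% S.lact_π_ψ, S.π_Ql,
    reassoc_of% S.γ_naturality₃, reassoc_of% lact_ract]

/-- The tensor product of a module with a morphism of modules. -/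
abbrev tensorLeft (N : S.Module) {X X' : S.Module} (g : X ⟶ X') :
    S.tensorObj N X ⟶ S.tensorObj N X' := SkewMonoidal.mkHom (S.Ql N.A g) (S.Ql_hom N g)

/-- The tensor product of a morphism of modules with a module. -/
abbrev tensorRight {N N' : S.Module} (f : N ⟶ N') (X : S.Module) :
    S.tensorObj N X ⟶ S.tensorObj N' X := SkewMonoidal.mkHom (S.Qr f.f X) (S.Qr_hom f X)

variable {S} in
lemma hom_ext_π {N : M} {X : S.Module} {B : M} {f g : S.Q N X ⟶ B}
    (h : S.π N X ≫ f = S.π N X ≫ g) : f = g := (cancel_epi _).1 h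

/-- The tensor product bifunctor on the category of modules. -/
def tensorModule : S.Module ⥤ S.Module ⥤ S.Module where
  obj N :=
    { obj X := S.tensorObj N X
      map g := S.tensorLeft N g
      map_id X := Monad.Algebra.Hom.ext (hom_ext_π (by
        change S.π N.A X ≫ S.Ql N.A (𝟙 X) = S.π N.A X ≫ 𝟙 _
        rw [S.π_Ql, id_f, lact_id, Category.id_comp, Category.comp_id]))
      map_comp f g := Monad.Algebra.Hom.ext (hom_ext_π (by
        change S.π N.A _ ≫ S.Ql N.A (f ≫ g) = S.π N.A _ ≫ S.Ql N.A f ≫ S.Ql N.A g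
        rw [S.π_Ql, comp_f, lact_comp, reassoc_of% S.π_Ql, S.π_Ql, Category.assoc])) }
  map f :=
    { app X := S.tensorRight f X
      naturality X Y g := Monad.Algebra.Hom.ext (hom_ext_π (by
        change S.π _ X ≫ S.Ql _ g ≫ S.Qr f.f Y = S.π _ X ≫ S.Qr f.f X ≫ S.Ql _ g
        rw [reassoc_of% S.π_Ql, S.π_Qr, reassoc_of% S.π_Qr, S.π_Ql, reassoc_of% lact_ract])) }
  map_id N := by
    ext X
    refine hom_ext_π (S := S) (N := N.A) (X := X) (by
      change S.π N.A X ≫ S.Qr (𝟙 N.A) X = S.π N.A X ≫ 𝟙 _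
      rw [S.π_Qr, ract_id, Category.id_comp, Category.comp_id])
  map_comp f g := by
    ext X
    refine hom_ext_π (S := S) (X := X) (by
      change S.π _ X ≫ S.Qr (f.f ≫ g.f) X = S.π _ X ≫ S.Qr f.f X ≫ S.Qr g.f X
      rw [S.π_Qr, ract_comp, reassoc_of% S.π_Qr, S.π_Qr, Category.assoc])

/-- The underlying morphism of the associativity constraint for modules. -/
def γQ (L : M) (N X : S.Module) : S.Q L (S.tensorObj N X) ⟶ S.Q (S.Q L N) X :=
  desc (S.Qγ L N.A X ≫ S.Qr (S.π L N) X) (by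
    -- The pair starts at `L * (R * Q N X)`, so the inner quotient has to be undone first; what
    -- remains is the balancing condition of `π L N`, whiskered by `X`.
    rw [← cancel_epi (lact S.tensor L (lact S.tensor S.unit (S.π N.A X))),
      reassoc_of% S.mu_naturality, reassoc_of% S.lact_π_Qγ, S.π_Qr,
      reassoc_of% lact_square _ _ (S.lact_π_act N X), lact_comp, Category.assoc,
      reassoc_of% S.lact_π_Qγ, S.π_Qr, reassoc_of% S.mu_γ, reassoc_of% S.γ_naturality₂,
      reassoc_of% ract_square _ (S.π_condition L N) X.A])

/-- This determines `γQ`, since both morphisms in front of it are epimorphisms; it is also exactly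
the associativity axiom for the forgetful functor with constraint `π`. -/
lemma π_γQ (L : M) (N X : S.Module) :
    lact S.tensor L (S.π N.A X) ≫ S.π L (S.tensorObj N X) ≫ S.γQ L N X =
      S.γ L N.A X.A ≫ ract S.tensor (S.π L N) X.A ≫ S.π (S.Q L N) X := by
  rw [γQ, π_desc, reassoc_of% S.lact_π_Qγ, S.π_Qr]

/-- The underlying morphism of the left unit constraint for modules. -/
def ηQ (X : S.Module) : X.A ⟶ S.Q S.unitObj.A X := S.η X.A ≫ S.π S.unit X

/-- The underlying morphism of the right unit constraint for modules. -/
def εQ (N : M) : S.Q N S.unitObj ⟶ N := desc (S.ε N) (S.mu_ε N)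

lemma π_εQ (N : M) : S.π N S.unitObj ≫ S.εQ N = S.ε N := π_desc _ _

/-- Precomposed with the map from `R * (L * (N * X))`, this is the pentagon with `R` in the first
place. -/
lemma γQ_hom (L N X : S.Module) :
    lact S.tensor S.unit (S.γQ L.A N X) ≫ S.ψ (S.tensorObj L N) X =
      S.ψ L (S.tensorObj N X) ≫ S.γQ L.A N X := by
  rw [← cancel_epi (lact S.tensor S.unit (S.π _ _)),
    ← cancel_epi (lact S.tensor S.unit (lact S.tensor _ (S.π _ _)))]
  have h := congrArg (lact S.tensor S.unit) (S.π_γQ L.A N X)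
  have h' := congrArg (fun f => ract S.tensor f X.A) (S.lact_π_act L N)
  simp only [lact_comp, ract_comp] at h h'
  rw [reassoc_of% S.lact_π_ψ, reassoc_of% S.γ_naturality₃, reassoc_of% lact_ract, S.π_γQ,
    reassoc_of% S.γ_naturality₁, reassoc_of% h, S.lact_π_ψ (S.tensorObj L N) X,
    reassoc_of% S.γ_naturality₂, reassoc_of% h', reassoc_of% S.pentagon]

/-- Both sides equal `π`: the left one by the triangle axiom; the right one because balancing trades
the action on `X` for `μ`, after which `η` and `γ` combine to `η_R * X`, which `ε_R * X` cancels. -/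
lemma ηQ_hom (X : S.Module) :
    lact S.tensor S.unit (S.ηQ X) ≫ S.ψ S.unitObj X = S.act X ≫ S.ηQ X := by
  rw [ηQ, lact_comp, Category.assoc, S.lact_π_ψ S.unitObj X, reassoc_of% S.η_γ_ε,
    reassoc_of% S.η_naturality, ← S.π_condition, SkewMonoidal.mu, Category.assoc,
    reassoc_of% S.η_γ, ← Category.assoc, ← ract_comp, S.η_ε, ract_id, Category.id_comp]

lemma εQ_hom (N : S.Module) :
    lact S.tensor S.unit (S.εQ N.A) ≫ S.act N = S.ψ N S.unitObj ≫ S.εQ N.A := by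
  rw [← cancel_epi (lact S.tensor S.unit (S.π N.A S.unitObj)), reassoc_of% S.lact_π_ψ,
    S.π_εQ, ← Category.assoc, ← lact_comp, S.π_εQ, S.ε_naturality]
  rw [← S.γ_ε, Category.assoc]

/-- The associativity constraint for modules. -/
abbrev γHom (L N X : S.Module) :
    S.tensorObj L (S.tensorObj N X) ⟶ S.tensorObj (S.tensorObj L N) X :=
  SkewMonoidal.mkHom (S.γQ L.A N X) (S.γQ_hom L N X)

/-- The left unit constraint for modules. -/
abbrev ηHom (X : S.Module) : X ⟶ S.tensorObj S.unitObj X :=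
  SkewMonoidal.mkHom (S.ηQ X) (S.ηQ_hom X)

/-- The right unit constraint for modules. -/
abbrev εHom (N : S.Module) : S.tensorObj N S.unitObj ⟶ N :=
  SkewMonoidal.mkHom (S.εQ N.A) (S.εQ_hom N)

lemma γQ_naturality₁ {L L' : M} (f : L ⟶ L') (N X : S.Module) :
    S.Qr f (S.tensorObj N X) ≫ S.γQ L' N X = S.γQ L N X ≫ S.Qr (S.Qr f N) X := by
  have h := congrArg (fun f => ract S.tensor f X.A) (S.π_Qr f N)
  simp only [ract_comp] at h
  rw [← cancel_epi (S.π _ _), ← cancel_epi (lact S.tensor L (S.π N.A X)),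
    reassoc_of% S.π_Qr, reassoc_of% S.π_γQ, S.π_Qr, reassoc_of% lact_ract, S.π_γQ,
    reassoc_of% S.γ_naturality₁, reassoc_of% h]

lemma γQ_naturality₂ (L : M) {N N' : S.Module} (g : N ⟶ N') (X : S.Module) :
    S.Ql L (S.tensorRight g X) ≫ S.γQ L N' X = S.γQ L N X ≫ S.Qr (S.Ql L g) X := by
  have h := congrArg (fun f => ract S.tensor f X.A) (S.π_Ql L g)
  have h' := congrArg (lact S.tensor L) (S.π_Qr g.f X)
  simp only [ract_comp, lact_comp] at h h'
  rw [← cancel_epi (S.π _ _), ← cancel_epi (lact S.tensor L (S.π N.A X)),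
    reassoc_of% S.π_Ql, reassoc_of% S.π_γQ, S.π_Qr, reassoc_of% h', S.π_γQ,
    reassoc_of% S.γ_naturality₂, reassoc_of% h]

lemma γQ_naturality₃ (L : M) (N : S.Module) {X X' : S.Module} (g : X ⟶ X') :
    S.Ql L (S.tensorLeft N g) ≫ S.γQ L N X' = S.γQ L N X ≫ S.Ql (S.Q L N) g := by
  have h' := congrArg (lact S.tensor L) (S.π_Ql N.A g)
  simp only [lact_comp] at h'
  rw [← cancel_epi (S.π _ _), ← cancel_epi (lact S.tensor L (S.π N.A X)),
    reassoc_of% S.π_Ql, reassoc_of% S.π_γQ, S.π_Ql, reassoc_of% h', S.π_γQ,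
    reassoc_of% S.γ_naturality₃, reassoc_of% lact_ract]

lemma ηQ_naturality {X X' : S.Module} (f : X ⟶ X') :
    f.f ≫ S.ηQ X' = S.ηQ X ≫ S.Ql S.unit f := by
  rw [ηQ, ηQ, Category.assoc, S.π_Ql, reassoc_of% S.η_naturality]

lemma εQ_naturality {N N' : M} (f : N ⟶ N') : S.Qr f S.unitObj ≫ S.εQ N' = S.εQ N ≫ f := by
  rw [← cancel_epi (S.π _ _), reassoc_of% S.π_Qr, S.π_εQ, reassoc_of% S.π_εQ, S.ε_naturality]

/-- Three nested quotients are cancelled, to reach `W * (X * (Y * Z))` and the pentagon of `M`. -/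
lemma γQ_pentagon (W : M) (X Y Z : S.Module) :
    S.Ql W (S.γHom X Y Z) ≫ S.γQ W (S.tensorObj X Y) Z ≫ S.Qr (S.γQ W X Y) Z =
      S.γQ W X (S.tensorObj Y Z) ≫ S.γQ (S.Q W X) Y Z := by
  have h₁ := congrArg (lact S.tensor W) (S.π_γQ X.A Y Z)
  have h₂ := congrArg (fun f => ract S.tensor f Z.A) (S.π_γQ W X Y)
  simp only [ract_comp, lact_comp] at h₁ h₂
  rw [← cancel_epi (S.π _ _), ← cancel_epi (lact S.tensor W (S.π _ _)),
    ← cancel_epi (lact S.tensor W (lact S.tensor X.A (S.π _ _))),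
    reassoc_of% S.π_Ql, reassoc_of% h₁, reassoc_of% S.π_γQ W (S.tensorObj X Y) Z, S.π_Qr,
    reassoc_of% S.γ_naturality₂, reassoc_of% h₂, reassoc_of% S.π_γQ W X (S.tensorObj Y Z),
    reassoc_of% S.γ_naturality₃, reassoc_of% lact_ract, S.π_γQ, reassoc_of% S.γ_naturality₁,
    reassoc_of% S.pentagon]

lemma ηQ_γQ (N X : S.Module) :
    S.ηQ (S.tensorObj N X) ≫ S.γQ S.unit N X = S.Qr (S.ηQ N) X := by
  rw [← cancel_epi (S.π _ _), S.π_Qr, ηQ, ηQ, Category.assoc, reassoc_of% S.η_naturality, S.π_γQ,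
    reassoc_of% S.η_γ, ract_comp, Category.assoc]

lemma γQ_εQ (N : M) (X : S.Module) :
    S.γQ N X S.unitObj ≫ S.εQ (S.Q N X) = S.Ql N (S.εHom X) := by
  rw [← cancel_epi (S.π _ _), ← cancel_epi (lact S.tensor N (S.π _ _)), reassoc_of% S.π_γQ,
    S.π_εQ, S.ε_naturality, reassoc_of% S.γ_ε, S.π_Ql, ← Category.assoc, ← lact_comp, S.π_εQ]

lemma ηQ_γQ_εQ (N : M) (X : S.Module) :
    S.Ql N (S.ηHom X) ≫ S.γQ N S.unitObj X ≫ S.Qr (S.εQ N) X = 𝟙 (S.Q N X) := by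
  have h : (S.ηHom X).f = S.η X.A ≫ S.π S.unit X := rfl
  rw [← cancel_epi (S.π _ _), reassoc_of% S.π_Ql, h, lact_comp, Category.assoc,
    reassoc_of% S.π_γQ N S.unitObj X, S.π_Qr, ← Category.assoc (ract _ _ _), ← ract_comp, S.π_εQ,
    reassoc_of% S.η_γ_ε, Category.comp_id]

lemma ηQ_εQ : S.ηQ S.unitObj ≫ S.εQ S.unit = 𝟙 S.unit := by
  rw [ηQ, Category.assoc, S.π_εQ, S.η_ε]

/-- The skew monoidal category of modules over a skew monoidal category. -/
def moduleSkewMonoidal : SkewMonoidal S.Module where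
  tensor := S.tensorModule
  unit := S.unitObj
  γ := S.γHom
  η := S.ηHom
  ε := S.εHom
  γ_naturality₁ f Y Z := Monad.Algebra.Hom.ext (S.γQ_naturality₁ f.f Y Z)
  γ_naturality₂ X _ _ g Z := Monad.Algebra.Hom.ext (S.γQ_naturality₂ X.A g Z)
  γ_naturality₃ X Y _ _ h := Monad.Algebra.Hom.ext (S.γQ_naturality₃ X.A Y h)
  η_naturality f := Monad.Algebra.Hom.ext (S.ηQ_naturality f)
  ε_naturality f := Monad.Algebra.Hom.ext (S.εQ_naturality f.f)
  pentagon W X Y Z := Monad.Algebra.Hom.ext (S.γQ_pentagon W.A X Y Z)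
  η_γ X Y := Monad.Algebra.Hom.ext (S.ηQ_γQ X Y)
  γ_ε X Y := Monad.Algebra.Hom.ext (S.γQ_εQ X.A Y)
  η_γ_ε X Y := Monad.Algebra.Hom.ext (S.ηQ_γQ_εQ X.A Y)
  η_ε := Monad.Algebra.Hom.ext S.ηQ_εQ

end SkewMonoidalActegory

/-! ### Actions of `V`: naturality of the coherence isomorphisms, and currying. -/

section Action

variable {V : Type u} [Category.{v} V] [MonoidalCategory V]
variable {M : Type u₁} [Category.{v₁} M] [MonoidalLeftAction V M]

lemma action_square (A : V) {Y₁ Y₂ Y₃ Y₄ : M} {f : Y₁ ⟶ Y₂} {g : Y₂ ⟶ Y₄} {f' : Y₁ ⟶ Y₃}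
    {g' : Y₃ ⟶ Y₄} (h : f ≫ g = f' ≫ g') : A ⊴ₗ f ≫ A ⊴ₗ g = A ⊴ₗ f' ≫ A ⊴ₗ g' := by
  rw [← MonoidalLeftAction.actionHomRight_comp, h, MonoidalLeftAction.actionHomRight_comp]

lemma assoc_inv_naturality (A B : V) {X Y : M} (f : X ⟶ Y) :
    A ⊴ₗ B ⊴ₗ f ≫ (αₗ A B Y).inv = (αₗ A B X).inv ≫ (A ⊗ B) ⊴ₗ f := by
  simp

lemma unit_inv_naturality {X Y : M} (f : X ⟶ Y) :
    f ≫ (λₗ[V] Y).inv = (λₗ[V] X).inv ≫ 𝟙_ V ⊴ₗ f :=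
  (MonoidalLeftAction.actionUnitIso_inv_naturality f).symm

section Curry

variable {X : M} {H : M ⥤ V} (adj : MonoidalLeftAction.actionRight V X ⊣ H)

/-- Currying for an object `X` with a right adjoint `H` to `- ⊙ X`. -/
def homCurry (A : V) (Y : M) : (A ⊙ₗ X ⟶ Y) ≃ (A ⟶ H.obj Y) := adj.homEquiv A Y

/-- Evaluation for an object `X` with a right adjoint `H` to `- ⊙ X`. -/
def homEval (Y : M) : H.obj Y ⊙ₗ X ⟶ Y := adj.counit.app Y

lemma homCurry_naturality {A B : V} {Y : M} (k : A ⟶ B) (f : B ⊙ₗ X ⟶ Y) :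
    homCurry adj A Y (k ⊵ₗ X ≫ f) = k ≫ homCurry adj B Y f := adj.homEquiv_naturality_left k f

lemma homCurry_eval {A : V} {Y : M} (k : A ⟶ H.obj Y) :
    homCurry adj A Y (k ⊵ₗ X ≫ homEval adj Y) = k := by
  have := (adj.homEquiv A Y).apply_symm_apply k
  rwa [Adjunction.homEquiv_counit] at this

end Curry

end Action

/-! ### The actegory of modules, its strengths, and the forgetful functor. -/

namespace SkewMonoidalActegory

variable {V : Type u} [Category.{v} V] [MonoidalCategory V] [SymmetricCategory V]
variable {M : Type u₁} [Category.{v₁} M] [MonoidalLeftAction V M]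
variable (S : SkewMonoidalActegory V M)

/-- The strength `Γ` is compatible with `μ`. -/
lemma Γ_mu (A : V) (N X : M) :
    A ⊴ₗ S.mu N X ≫ S.Γ A N X = S.Γ A N (prod S.tensor S.unit X) ≫ S.mu (A ⊙ₗ N) X := by
  rw [SkewMonoidal.mu, SkewMonoidal.mu, MonoidalLeftAction.actionHomRight_comp, Category.assoc,
    S.Γ_naturality₁, reassoc_of% S.γ_strength₁, ← ract_comp, S.ε_strength]

/-- The strength `Γ'` is compatible with `μ`. -/
lemma Γ'_mu (A : V) (N X : M) :
    A ⊴ₗ S.mu N X ≫ S.Γ' A N X =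
      S.Γ' A N (prod S.tensor S.unit X) ≫ lact S.tensor N (S.Γ' A S.unit X) ≫
        S.mu N (A ⊙ₗ X) := by
  rw [SkewMonoidal.mu, SkewMonoidal.mu, MonoidalLeftAction.actionHomRight_comp, Category.assoc,
    S.Γ'_naturality₁, reassoc_of% S.γ_strength₃]

variable [hE : Fact S.IsR2Exact]

instance isIso_Γ' (A : V) (X Y : M) : IsIso (S.Γ' A X Y) := hE.out.strong A X Y

/-- The structure map of the action of `A` on a module. -/
def actionAct (A : V) (X : S.Module) : prod S.tensor S.unit (A ⊙ₗ X.A) ⟶ A ⊙ₗ X.A :=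
  inv (S.Γ' A S.unit X.A) ≫ A ⊴ₗ S.act X

lemma Γ'_actionAct (A : V) (X : S.Module) :
    S.Γ' A S.unit X.A ≫ S.actionAct A X = A ⊴ₗ S.act X := by
  rw [actionAct, IsIso.hom_inv_id_assoc]

lemma η_actionAct (A : V) (X : S.Module) : S.η (A ⊙ₗ X.A) ≫ S.actionAct A X = 𝟙 _ := by
  rw [← S.η_strength, Category.assoc, Γ'_actionAct, ← MonoidalLeftAction.actionHomRight_comp,
    S.act_unit, MonoidalLeftAction.actionHomRight_id]

/-- Cancelling the isomorphisms `Γ'` and `R * Γ'` turns the law into `A ⊙ -` applied to the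
associativity of `X`; `Γ'_mu` is what carries `μ` across. -/
lemma mu_actionAct (A : V) (X : S.Module) :
    S.mu S.unit (A ⊙ₗ X.A) ≫ S.actionAct A X =
      lact S.tensor S.unit (S.actionAct A X) ≫ S.actionAct A X := by
  rw [← cancel_epi (lact S.tensor S.unit (S.Γ' A S.unit X.A)), ← cancel_epi (S.Γ' A S.unit _),
    ← reassoc_of% S.Γ'_mu, S.Γ'_actionAct, ← Category.assoc (lact _ _ _), ← lact_comp,
    S.Γ'_actionAct, ← reassoc_of% S.Γ'_naturality₂, S.Γ'_actionAct,
    action_square _ (S.act_assoc X)]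

/-- The action of `V` on modules. -/
abbrev actionObj (A : V) (X : S.Module) : S.Module :=
  S.mkModule (A ⊙ₗ X.A) (S.actionAct A X) (S.η_actionAct A X) (S.mu_actionAct A X)

lemma Γ'_act (A : V) (X : S.Module) :
    S.Γ' A S.unit X.A ≫ S.act (S.actionObj A X) = A ⊴ₗ S.act X := S.Γ'_actionAct A X

/-- The action of an object of `V` on morphisms of modules. -/
abbrev actionRight (A : V) {X Y : S.Module} (f : X ⟶ Y) : S.actionObj A X ⟶ S.actionObj A Y :=
  SkewMonoidal.mkHom (A ⊴ₗ f.f) (by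
    rw [← cancel_epi (S.Γ' A S.unit X.A), ← reassoc_of% S.Γ'_naturality₂, S.Γ'_act,
      reassoc_of% S.Γ'_act, action_square _ (S.hom_act f)])

/-- The action of morphisms of `V` on modules. -/
abbrev actionLeft {A B : V} (a : A ⟶ B) (X : S.Module) : S.actionObj A X ⟶ S.actionObj B X :=
  SkewMonoidal.mkHom (a ⊵ₗ X.A) (by
    rw [← cancel_epi (S.Γ' A S.unit X.A), ← reassoc_of% S.Γ'_naturality₀, S.Γ'_act,
      reassoc_of% S.Γ'_act, MonoidalLeftAction.action_exchange])

lemma assoc_inv_hom (A B : V) (X : S.Module) :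
    lact S.tensor S.unit (αₗ A B X.A).inv ≫ S.actionAct (A ⊗ B) X =
      S.actionAct A (S.actionObj B X) ≫ (αₗ A B X.A).inv := by
  have h := congrArg (fun f => A ⊴ₗ f) (S.Γ'_act B X)
  simp only [MonoidalLeftAction.actionHomRight_comp] at h
  rw [← cancel_epi (S.Γ' A S.unit (B ⊙ₗ X.A)), ← cancel_epi (A ⊴ₗ S.Γ' B S.unit X.A),
    ← reassoc_of% S.Γ'_assoc, S.Γ'_actionAct, reassoc_of% S.Γ'_actionAct A (S.actionObj B X),
    reassoc_of% h, assoc_inv_naturality]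

lemma unit_inv_hom (X : S.Module) :
    lact S.tensor S.unit (λₗ[V] X.A).inv ≫ S.actionAct (𝟙_ V) X =
      S.act X ≫ (λₗ[V] X.A).inv := by
  rw [← S.Γ'_unit, Category.assoc, S.Γ'_actionAct, unit_inv_naturality]

/-- Modules over a skew monoidal actegory form an actegory. -/
instance moduleAction : MonoidalLeftAction V S.Module where
  actionObj A X := S.actionObj A X
  actionHomLeft a X := S.actionLeft a X
  actionHomRight A _ _ f := S.actionRight A f
  actionAssocIso A B X :=
    (Monad.Algebra.isoMk (A := S.actionObj A (S.actionObj B X)) (B := S.actionObj (A ⊗ B) X)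
      (αₗ A B X.A).symm (S.assoc_inv_hom A B X)).symm
  actionUnitIso X :=
    (Monad.Algebra.isoMk (A := X) (B := S.actionObj (𝟙_ V) X)
      (λₗ[V] X.A).symm (S.unit_inv_hom X)).symm
  actionHomRight_id c d := Monad.Algebra.Hom.ext (MonoidalLeftAction.actionHomRight_id c d.A)
  id_actionHomLeft c d := Monad.Algebra.Hom.ext (MonoidalLeftAction.id_actionHomLeft c d.A)
  actionHom_comp f₁ f₂ g₁ g₂ := Monad.Algebra.Hom.ext (by
    have := MonoidalLeftAction.actionHom_comp f₁ f₂ g₁.f g₂.f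
    simp only [MonoidalLeftAction.actionHom_def] at this
    exact this)
  actionAssocIso_hom_naturality f g h := Monad.Algebra.Hom.ext (by
    have := MonoidalLeftAction.actionAssocIso_hom_naturality f g h.f
    simp only [MonoidalLeftAction.actionHom_def] at this
    exact this)
  actionUnitIso_hom_naturality f := Monad.Algebra.Hom.ext
    (MonoidalLeftAction.actionUnitIso_hom_naturality f.f)
  whiskerLeft_actionHomLeft c _ _ f d := Monad.Algebra.Hom.ext
    (MonoidalLeftAction.whiskerLeft_actionHomLeft c f d.A)
  whiskerRight_actionHomLeft c f d := Monad.Algebra.Hom.ext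
    (MonoidalLeftAction.whiskerRight_actionHomLeft c f d.A)
  associator_actionHom a b c d := Monad.Algebra.Hom.ext
    (MonoidalLeftAction.associator_actionHom a b c d.A)
  leftUnitor_actionHom c d := Monad.Algebra.Hom.ext
    (MonoidalLeftAction.leftUnitor_actionHom c d.A)
  rightUnitor_actionHom c d := Monad.Algebra.Hom.ext
    (MonoidalLeftAction.rightUnitor_actionHom c d.A)

/-- The underlying morphism of the first strength for modules. -/
def ΓQ (A : V) (N : M) (X : S.Module) : A ⊙ₗ S.Q N X ⟶ S.Q (A ⊙ₗ N) X :=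
  actionDesc (S.Γ A N X.A ≫ S.π (A ⊙ₗ N) X) (by
    rw [reassoc_of% S.Γ_mu, S.π_condition, reassoc_of% S.Γ_naturality₂])

lemma π_ΓQ (A : V) (N : M) (X : S.Module) :
    A ⊴ₗ S.π N X ≫ S.ΓQ A N X = S.Γ A N X.A ≫ S.π (A ⊙ₗ N) X := action_π_actionDesc _ _

/-- The underlying morphism of the second strength for modules. -/
def ΓQ' (A : V) (N : M) (X : S.Module) : A ⊙ₗ S.Q N X ⟶ S.Q N (S.actionObj A X) :=
  actionDesc (S.Γ' A N X.A ≫ S.π N (S.actionObj A X)) (by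
    rw [reassoc_of% S.Γ'_mu, S.π_condition N (S.actionObj A X), reassoc_of% S.Γ'_naturality₂,
      ← S.Γ'_act A X, lact_comp, Category.assoc])

lemma π_ΓQ' (A : V) (N : M) (X : S.Module) :
    A ⊴ₗ S.π N X ≫ S.ΓQ' A N X = S.Γ' A N X.A ≫ S.π N (S.actionObj A X) :=
  action_π_actionDesc _ _

/-- The inverse of the second strength for modules. -/
def ΓQ'Inv (A : V) (N : M) (X : S.Module) : S.Q N (S.actionObj A X) ⟶ A ⊙ₗ S.Q N X :=
  desc (inv (S.Γ' A N X.A) ≫ A ⊴ₗ S.π N X) (by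
    have h := congrArg (fun f => A ⊴ₗ f) (S.π_condition N X)
    have h' := congrArg (lact S.tensor N) (S.Γ'_act A X)
    simp only [MonoidalLeftAction.actionHomRight_comp, lact_comp] at h h'
    -- These two isomorphisms carry the pair for `A ⊙ X` to `A ⊙ -` of the pair for `X`, where the
    -- balancing condition of `π N X` applies.
    rw [← cancel_epi (lact S.tensor N (S.Γ' A S.unit X.A)),
      ← cancel_epi (S.Γ' A N (prod S.tensor S.unit X.A)), ← reassoc_of% S.Γ'_mu, reassoc_of% h',
      ← reassoc_of% S.Γ'_naturality₂, IsIso.hom_inv_id_assoc, h])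

lemma π_ΓQ'Inv (A : V) (N : M) (X : S.Module) :
    S.π N (S.actionObj A X) ≫ S.ΓQ'Inv A N X = inv (S.Γ' A N X.A) ≫ A ⊴ₗ S.π N X := π_desc _ _

instance isIso_ΓQ' (A : V) (N : M) (X : S.Module) : IsIso (S.ΓQ' A N X) :=
  ⟨S.ΓQ'Inv A N X,
    by rw [← cancel_epi (A ⊴ₗ S.π N X), reassoc_of% S.π_ΓQ', S.π_ΓQ'Inv,
        IsIso.hom_inv_id_assoc, Category.comp_id],
    by rw [← cancel_epi (S.π N _), reassoc_of% S.π_ΓQ'Inv, S.π_ΓQ', IsIso.inv_hom_id_assoc,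
        Category.comp_id]⟩

lemma action_π_ψ (A : V) (N X : S.Module) :
    A ⊴ₗ lact S.tensor S.unit (S.π N.A X) ≫ A ⊴ₗ S.ψ N X =
      A ⊴ₗ S.γ S.unit N.A X.A ≫ A ⊴ₗ ract S.tensor (S.act N) X.A ≫ A ⊴ₗ S.π N.A X := by
  have h := congrArg (fun f => A ⊴ₗ f) (S.lact_π_ψ N X)
  simpa only [MonoidalLeftAction.actionHomRight_comp] using h

/-- The action on `A ⊙ N` involves `Γ'` while `ΓQ` involves `Γ`; the strength axiom for `γ` in its
middle variable reconciles them. -/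
lemma ΓQ_hom (A : V) (N X : S.Module) :
    lact S.tensor S.unit (S.ΓQ A N.A X) ≫ S.ψ (S.actionObj A N) X =
      S.actionAct A (S.tensorObj N X) ≫ S.ΓQ A N.A X := by
  have h := congrArg (lact S.tensor S.unit) (S.π_ΓQ A N.A X)
  have h' := congrArg (fun f => ract S.tensor f X.A) (S.Γ'_act A N)
  simp only [lact_comp, ract_comp] at h h'
  rw [← cancel_epi (S.Γ' A S.unit _), ← cancel_epi (A ⊴ₗ lact S.tensor S.unit (S.π N.A X)),
    reassoc_of% S.Γ'_actionAct A (S.tensorObj N X), reassoc_of% S.Γ'_naturality₂,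
    reassoc_of% h, S.lact_π_ψ (S.actionObj A N) X, reassoc_of% S.action_π_ψ, S.π_ΓQ,
    reassoc_of% S.Γ_naturality₁, reassoc_of% S.γ_strength₂, reassoc_of% h']

/-- Here the strength axiom for `γ` in its last variable is the one needed. -/
lemma ΓQ'_hom (A : V) (N X : S.Module) :
    lact S.tensor S.unit (S.ΓQ' A N.A X) ≫ S.ψ N (S.actionObj A X) =
      S.actionAct A (S.tensorObj N X) ≫ S.ΓQ' A N.A X := by
  have h := congrArg (lact S.tensor S.unit) (S.π_ΓQ' A N.A X)
  simp only [lact_comp] at h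
  rw [← cancel_epi (S.Γ' A S.unit _), ← cancel_epi (A ⊴ₗ lact S.tensor S.unit (S.π N.A X)),
    reassoc_of% S.Γ'_actionAct A (S.tensorObj N X), reassoc_of% S.Γ'_naturality₂,
    reassoc_of% h, S.lact_π_ψ N (S.actionObj A X), reassoc_of% S.action_π_ψ, S.π_ΓQ',
    reassoc_of% S.Γ'_naturality₁, reassoc_of% S.γ_strength₃]

/-- The first strength for modules. -/
abbrev ΓHom (A : V) (N X : S.Module) :
    A ⊙ₗ S.tensorObj N X ⟶ S.tensorObj (A ⊙ₗ N) X :=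
  SkewMonoidal.mkHom (A := S.actionObj A (S.tensorObj N X))
    (B := S.tensorObj (S.actionObj A N) X) (S.ΓQ A N.A X) (S.ΓQ_hom A N X)

/-- The second strength for modules. -/
abbrev ΓHom' (A : V) (N X : S.Module) :
    A ⊙ₗ S.tensorObj N X ⟶ S.tensorObj N (A ⊙ₗ X) :=
  SkewMonoidal.mkHom (A := S.actionObj A (S.tensorObj N X))
    (B := S.tensorObj N (S.actionObj A X)) (S.ΓQ' A N.A X) (S.ΓQ'_hom A N X)

lemma ΓQ_naturality₀ {A B : V} (a : A ⟶ B) (N : M) (X : S.Module) :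
    a ⊵ₗ S.Q N X ≫ S.ΓQ B N X = S.ΓQ A N X ≫ S.Qr (a ⊵ₗ N) X := by
  rw [← cancel_epi (A ⊴ₗ S.π N X), reassoc_of% S.π_ΓQ, S.π_Qr,
    MonoidalLeftAction.action_exchange_assoc, S.π_ΓQ, reassoc_of% S.Γ_naturality₀]

lemma ΓQ_naturality₁ (A : V) {N N' : M} (f : N ⟶ N') (X : S.Module) :
    A ⊴ₗ S.Qr f X ≫ S.ΓQ A N' X = S.ΓQ A N X ≫ S.Qr (A ⊴ₗ f) X := by
  rw [← cancel_epi (A ⊴ₗ S.π N X), reassoc_of% S.π_ΓQ, S.π_Qr,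
    reassoc_of% action_square A (S.π_Qr f X), S.π_ΓQ, reassoc_of% S.Γ_naturality₁]

lemma ΓQ_naturality₂ (A : V) (N : M) {X X' : S.Module} (g : X ⟶ X') :
    A ⊴ₗ S.Ql N g ≫ S.ΓQ A N X' = S.ΓQ A N X ≫ S.Ql (A ⊙ₗ N) g := by
  rw [← cancel_epi (A ⊴ₗ S.π N X), reassoc_of% S.π_ΓQ, S.π_Ql,
    reassoc_of% action_square A (S.π_Ql N g), S.π_ΓQ, reassoc_of% S.Γ_naturality₂]

lemma ΓQ'_naturality₀ {A B : V} (a : A ⟶ B) (N : M) (X : S.Module) :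
    a ⊵ₗ S.Q N X ≫ S.ΓQ' B N X = S.ΓQ' A N X ≫ S.Ql N (S.actionLeft a X) := by
  rw [← cancel_epi (A ⊴ₗ S.π N X), reassoc_of% S.π_ΓQ', S.π_Ql,
    MonoidalLeftAction.action_exchange_assoc, S.π_ΓQ', reassoc_of% S.Γ'_naturality₀]

lemma ΓQ'_naturality₁ (A : V) {N N' : M} (f : N ⟶ N') (X : S.Module) :
    A ⊴ₗ S.Qr f X ≫ S.ΓQ' A N' X = S.ΓQ' A N X ≫ S.Qr f (S.actionObj A X) := by
  rw [← cancel_epi (A ⊴ₗ S.π N X), reassoc_of% S.π_ΓQ', S.π_Qr,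
    reassoc_of% action_square A (S.π_Qr f X), S.π_ΓQ', reassoc_of% S.Γ'_naturality₁]

lemma ΓQ'_naturality₂ (A : V) (N : M) {X X' : S.Module} (g : X ⟶ X') :
    A ⊴ₗ S.Ql N g ≫ S.ΓQ' A N X' = S.ΓQ' A N X ≫ S.Ql N (S.actionRight A g) := by
  rw [← cancel_epi (A ⊴ₗ S.π N X), reassoc_of% S.π_ΓQ', S.π_Ql,
    reassoc_of% action_square A (S.π_Ql N g), S.π_ΓQ', reassoc_of% S.Γ'_naturality₂]

lemma ΓQ_assoc (A B : V) (N : M) (X : S.Module) :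
    (αₗ A B (S.Q N X)).inv ≫ S.ΓQ (A ⊗ B) N X =
      A ⊴ₗ S.ΓQ B N X ≫ S.ΓQ A (B ⊙ₗ N) X ≫ S.Qr (αₗ A B N).inv X := by
  rw [← cancel_epi (A ⊴ₗ B ⊴ₗ S.π N X), reassoc_of% assoc_inv_naturality, S.π_ΓQ,
    reassoc_of% action_square A (S.π_ΓQ B N X), reassoc_of% S.π_ΓQ, S.π_Qr,
    reassoc_of% S.Γ_assoc]

lemma ΓQ_unit (N : M) (X : S.Module) :
    (λₗ[V] (S.Q N X)).inv ≫ S.ΓQ (𝟙_ V) N X = S.Qr (λₗ[V] N).inv X := by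
  rw [← cancel_epi (S.π N X), ← Category.assoc, unit_inv_naturality, Category.assoc, S.π_ΓQ,
    reassoc_of% S.Γ_unit, S.π_Qr]

lemma ΓQ'_assoc (A B : V) (N : M) (X : S.Module) :
    (αₗ A B (S.Q N X)).inv ≫ S.ΓQ' (A ⊗ B) N X =
      A ⊴ₗ S.ΓQ' B N X ≫ S.ΓQ' A N (B ⊙ₗ X) ≫ S.Ql N (αₗ A B X).inv := by
  have h : (αₗ A B X).inv.f = (αₗ A B X.A).inv := rfl
  rw [← cancel_epi (A ⊴ₗ B ⊴ₗ S.π N X), reassoc_of% assoc_inv_naturality, S.π_ΓQ',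
    reassoc_of% action_square A (S.π_ΓQ' B N X)]
  erw [reassoc_of% S.π_ΓQ' A N (S.actionObj B X)]
  rw [S.π_Ql, h, reassoc_of% S.Γ'_assoc]
  rfl

lemma ΓQ'_unit (N : M) (X : S.Module) :
    (λₗ[V] (S.Q N X)).inv ≫ S.ΓQ' (𝟙_ V) N X = S.Ql N (λₗ[V] X).inv := by
  have h : (λₗ[V] X).inv.f = (λₗ[V] X.A).inv := rfl
  rw [← cancel_epi (S.π N X), ← Category.assoc, unit_inv_naturality, Category.assoc, S.π_ΓQ',
    reassoc_of% S.Γ'_unit, S.π_Ql, h]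
  rfl

lemma ΓQ_ΓQ' (A B : V) (N : M) (X : S.Module) :
    A ⊴ₗ S.ΓQ B N X ≫ S.ΓQ' A (B ⊙ₗ N) X =
      (αₗ A B (S.Q N X)).inv ≫ (β_ A B).hom ⊵ₗ S.Q N X ≫ (αₗ B A (S.Q N X)).hom ≫
        B ⊴ₗ S.ΓQ' A N X ≫ S.ΓQ B N (S.actionObj A X) := by
  have h : (B ⊗ A) ⊴ₗ S.π N X ≫ (αₗ B A (S.Q N X)).hom =
      (αₗ B A _).hom ≫ B ⊴ₗ A ⊴ₗ S.π N X := by simp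
  rw [← cancel_epi (A ⊴ₗ B ⊴ₗ S.π N X), reassoc_of% action_square A (S.π_ΓQ B N X), S.π_ΓQ',
    reassoc_of% S.Γ_Γ', reassoc_of% assoc_inv_naturality,
    MonoidalLeftAction.action_exchange_assoc, reassoc_of% h,
    reassoc_of% action_square B (S.π_ΓQ' A N X), S.π_ΓQ]

lemma action_π_γQ (A : V) (L : M) (N X : S.Module) :
    A ⊴ₗ lact S.tensor L (S.π N.A X) ≫ A ⊴ₗ S.π L (S.tensorObj N X) ≫ A ⊴ₗ S.γQ L N X =
      A ⊴ₗ S.γ L N.A X.A ≫ A ⊴ₗ ract S.tensor (S.π L N) X.A ≫ A ⊴ₗ S.π (S.Q L N) X := by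
  have h := congrArg (fun f => A ⊴ₗ f) (S.π_γQ L N X)
  simpa only [MonoidalLeftAction.actionHomRight_comp] using h

lemma γQ_strength₁ (A : V) (L : M) (N X : S.Module) :
    S.ΓQ A L (S.tensorObj N X) ≫ S.γQ (A ⊙ₗ L) N X =
      A ⊴ₗ S.γQ L N X ≫ S.ΓQ A (S.Q L N) X ≫ S.Qr (S.ΓQ A L N) X := by
  rw [← cancel_epi (A ⊴ₗ S.π L (S.tensorObj N X)),
    ← cancel_epi (A ⊴ₗ lact S.tensor L (S.π N.A X)), reassoc_of% S.π_ΓQ,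
    reassoc_of% S.Γ_naturality₂, S.π_γQ, reassoc_of% S.γ_strength₁,
    reassoc_of% S.action_π_γQ, reassoc_of% S.π_ΓQ, S.π_Qr,
    reassoc_of% S.Γ_naturality₁, reassoc_of% ract_square _ (S.π_ΓQ A L N) X.A]

lemma γQ_strength₂ (A : V) (L : M) (N X : S.Module) :
    S.ΓQ' A L (S.tensorObj N X) ≫ S.Ql L (S.ΓHom A N X) ≫ S.γQ L (S.actionObj A N) X =
      A ⊴ₗ S.γQ L N X ≫ S.ΓQ A (S.Q L N) X ≫ S.Qr (S.ΓQ' A L N) X := by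
  have h : S.π L (S.actionObj A (S.tensorObj N X)) ≫ S.Ql L (S.ΓHom A N X) =
    lact S.tensor L (S.ΓQ A N.A X) ≫ S.π L (S.tensorObj (S.actionObj A N) X) := S.π_Ql _ _
  rw [← cancel_epi (A ⊴ₗ S.π L (S.tensorObj N X)),
    ← cancel_epi (A ⊴ₗ lact S.tensor L (S.π N.A X)), reassoc_of% S.π_ΓQ', reassoc_of% h,
    reassoc_of% S.Γ'_naturality₂, reassoc_of% lact_square _ L (S.π_ΓQ A N.A X),
    S.π_γQ L (S.actionObj A N) X, reassoc_of% S.γ_strength₂,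
    reassoc_of% S.action_π_γQ, reassoc_of% S.π_ΓQ, S.π_Qr,
    reassoc_of% S.Γ_naturality₁, reassoc_of% ract_square _ (S.π_ΓQ' A L N) X.A]

lemma γQ_strength₃ (A : V) (L : M) (N X : S.Module) :
    S.ΓQ' A L (S.tensorObj N X) ≫ S.Ql L (S.ΓHom' A N X) ≫ S.γQ L N (S.actionObj A X) =
      A ⊴ₗ S.γQ L N X ≫ S.ΓQ' A (S.Q L N) X := by
  have h : S.π L (S.actionObj A (S.tensorObj N X)) ≫ S.Ql L (S.ΓHom' A N X) =
    lact S.tensor L (S.ΓQ' A N.A X) ≫ S.π L (S.tensorObj N (S.actionObj A X)) := S.π_Ql _ _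
  rw [← cancel_epi (A ⊴ₗ S.π L (S.tensorObj N X)),
    ← cancel_epi (A ⊴ₗ lact S.tensor L (S.π N.A X)), reassoc_of% S.π_ΓQ', reassoc_of% h,
    reassoc_of% S.Γ'_naturality₂, reassoc_of% lact_square _ L (S.π_ΓQ' A N.A X),
    S.π_γQ L N (S.actionObj A X), reassoc_of% S.γ_strength₃,
    reassoc_of% S.action_π_γQ, S.π_ΓQ', reassoc_of% S.Γ'_naturality₁]

lemma ηQ_strength (A : V) (X : S.Module) :
    A ⊴ₗ S.ηQ X ≫ S.ΓQ' A S.unit X = S.ηQ (S.actionObj A X) := by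
  rw [ηQ, ηQ, MonoidalLeftAction.actionHomRight_comp, Category.assoc, S.π_ΓQ',
    reassoc_of% S.η_strength]

lemma εQ_strength (A : V) (N : M) : S.ΓQ A N S.unitObj ≫ S.εQ (A ⊙ₗ N) = A ⊴ₗ S.εQ N := by
  rw [← cancel_epi (A ⊴ₗ S.π N S.unitObj), reassoc_of% S.π_ΓQ, S.π_εQ, S.ε_strength,
    ← MonoidalLeftAction.actionHomRight_comp, S.π_εQ]

/-- Modules over a skew monoidal actegory form a skew monoidal actegory. -/
def moduleActegory : SkewMonoidalActegory V S.Module where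
  toSkewMonoidal := S.moduleSkewMonoidal
  Γ := S.ΓHom
  Γ' := S.ΓHom'
  Γ_naturality₀ a X Y := Monad.Algebra.Hom.ext (S.ΓQ_naturality₀ a X.A Y)
  Γ_naturality₁ A _ _ f Y := Monad.Algebra.Hom.ext (S.ΓQ_naturality₁ A f.f Y)
  Γ_naturality₂ A X _ _ g := Monad.Algebra.Hom.ext (S.ΓQ_naturality₂ A X.A g)
  Γ'_naturality₀ a X Y := Monad.Algebra.Hom.ext (S.ΓQ'_naturality₀ a X.A Y)
  Γ'_naturality₁ A _ _ f Y := Monad.Algebra.Hom.ext (S.ΓQ'_naturality₁ A f.f Y)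
  Γ'_naturality₂ A X _ _ g := Monad.Algebra.Hom.ext (S.ΓQ'_naturality₂ A X.A g)
  Γ_assoc A B X Y := Monad.Algebra.Hom.ext (S.ΓQ_assoc A B X.A Y)
  Γ_unit X Y := Monad.Algebra.Hom.ext (S.ΓQ_unit X.A Y)
  Γ'_assoc A B X Y := Monad.Algebra.Hom.ext (S.ΓQ'_assoc A B X.A Y)
  Γ'_unit X Y := Monad.Algebra.Hom.ext (S.ΓQ'_unit X.A Y)
  Γ_Γ' A B X Y := Monad.Algebra.Hom.ext (S.ΓQ_ΓQ' A B X.A Y)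
  γ_strength₁ A X Y Z := Monad.Algebra.Hom.ext (S.γQ_strength₁ A X.A Y Z)
  γ_strength₂ A X Y Z := Monad.Algebra.Hom.ext (S.γQ_strength₂ A X.A Y Z)
  γ_strength₃ A X Y Z := Monad.Algebra.Hom.ext (S.γQ_strength₃ A X.A Y Z)
  η_strength A X := Monad.Algebra.Hom.ext (S.ηQ_strength A X)
  ε_strength A X := Monad.Algebra.Hom.ext (S.εQ_strength A X.A)

/-- The forgetful functor from modules is a skew monoidal functor. -/
def forgetSkewMonoidalFunctor :
    SkewMonoidalFunctor S.moduleSkewMonoidal S.toSkewMonoidal S.forget where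
  F₂ N X := S.π N.A X
  F₀ := 𝟙 S.unit
  F₂_naturality₁ f Y := (S.π_Qr f.f Y).symm
  F₂_naturality₂ X _ _ g := (S.π_Ql X.A g).symm
  map_γ X Y Z := S.π_γQ X.A Y Z
  map_η X := by
    change S.η X.A ≫ ract S.tensor (𝟙 S.unit) X.A ≫ S.π S.unit X = S.η X.A ≫ S.π S.unit X
    rw [ract_id, Category.id_comp]
  map_ε N := by
    change lact S.tensor N.A (𝟙 S.unit) ≫ S.π N.A S.unitObj ≫ S.εQ N.A = S.ε N.A
    rw [lact_id, Category.id_comp, S.π_εQ]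

/-- The forgetful functor from modules is a strict morphism of actegories. -/
abbrev forgetLaxLeftLinear : S.forget.LaxLeftLinear V where
  μₗ A X := 𝟙 (A ⊙ₗ X.A)
  μₗ_naturality_left a X := (Category.comp_id _).trans (Category.id_comp _).symm
  μₗ_naturality_right A _ _ f := (Category.comp_id _).trans (Category.id_comp _).symm
  μₗ_associativity A B X := by
    change 𝟙 _ ≫ (αₗ A B X.A).hom = (αₗ A B X.A).hom ≫ A ⊴ₗ 𝟙 (B ⊙ₗ X.A) ≫ 𝟙 _
    simp
  μₗ_unitality X := (Category.id_comp _).symm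

/-- The forgetful functor from modules is a skew monoidal `V`-functor. -/
def forgetSkewMonoidalVFunctor : SkewMonoidalVFunctor S.moduleActegory S S.forget where
  toSkewMonoidalFunctor := S.forgetSkewMonoidalFunctor
  strength := S.forgetLaxLeftLinear
  F₂_strength₁ A X Y := by
    change A ⊴ₗ S.π X.A Y ≫ 𝟙 (A ⊙ₗ S.Q X.A Y) ≫ S.ΓQ A X.A Y =
      S.Γ A X.A Y.A ≫ ract S.tensor (𝟙 (A ⊙ₗ X.A)) Y.A ≫ S.π (A ⊙ₗ X.A) Y
    rw [ract_id, Category.id_comp, Category.id_comp, S.π_ΓQ]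
  F₂_strength₂ A X Y := by
    change A ⊴ₗ S.π X.A Y ≫ 𝟙 (A ⊙ₗ S.Q X.A Y) ≫ S.ΓQ' A X.A Y =
      S.Γ' A X.A Y.A ≫ lact S.tensor X.A (𝟙 (A ⊙ₗ Y.A)) ≫ S.π X.A (S.actionObj A Y)
    rw [lact_id, Category.id_comp, Category.id_comp, S.π_ΓQ']

/-! ### Reflexive coequalizers of modules and their preservation. -/

section Exactness

/-- The forgetful functor from modules creates reflexive coequalizers. -/
instance createsColimitForget {X Y : S.Module} (f g : X ⟶ Y) [IsReflexivePair f g] :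
    CreatesColimit (parallelPair f g) S.forget :=
  have hR := hE.out.tensor_preserves S.unit
  have : PreservesColimit (parallelPair f g ⋙ S.forget) S.canonicalMonad.toFunctor :=
    preservesColimit_parallelPair_comp S.forget _ hR f g
  -- Preservation by `T` gives the structure map on the coequalizer; preservation after a further
  -- `T` is needed for its associativity law.
  have : PreservesColimit ((parallelPair f g ⋙ S.forget) ⋙ S.canonicalMonad.toFunctor)
      S.canonicalMonad.toFunctor :=
    preservesColimit_parallelPair_comp (S.forget ⋙ S.canonicalMonad.toFunctor) _ hR f g
  Monad.forgetCreatesColimit (parallelPair f g)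

instance hasColimit_parallelPair_comp_forget {X Y : S.Module} (f g : X ⟶ Y)
    [IsReflexivePair f g] : HasColimit (parallelPair f g ⋙ S.forget) :=
  have := isReflexivePair_map S.forget f g
  have := hE.out.hasReflexiveCoequalizers.has_coeq (S.forget.map f) (S.forget.map g)
  hasColimit_of_iso (F := parallelPair (S.forget.map f) (S.forget.map g))
    (diagramIsoParallelPair (parallelPair f g ⋙ S.forget))

lemma module_hasReflexiveCoequalizers : HasReflexiveCoequalizers S.Module where
  has_coeq _ _ f g _ := hasColimit_of_created (parallelPair f g) S.forget

/-- An endofunctor of the category of modules preserves reflexive coequalizers if it sends them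
to coequalizers of the underlying morphisms. -/
lemma preservesColimitOfIsReflexivePair_of_forget (F : S.Module ⥤ S.Module)
    (h : ∀ {X Y Z : S.Module} (f g : X ⟶ Y) (q : Y ⟶ Z) (w : f.f ≫ q.f = g.f ≫ q.f)
      (w' : (F.map f).f ≫ (F.map q).f = (F.map g).f ≫ (F.map q).f), IsReflexivePair f g →
      IsColimit (Cofork.ofπ q.f w) → Nonempty (IsColimit (Cofork.ofπ (F.map q).f w'))) :
    Monad.PreservesColimitOfIsReflexivePair F where
  out X Y f g _ := by
    have := S.module_hasReflexiveCoequalizers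
    -- Reflexivity of the image pair allows the forgetful functor to reflect its coequalizer.
    have := isReflexivePair_map F f g
    have w := coequalizer.condition f g
    have wF : F.map f ≫ F.map (coequalizer.π f g) = F.map g ≫ F.map (coequalizer.π f g) := by
      rw [← F.map_comp, w, F.map_comp]
    obtain ⟨l⟩ := h f g (coequalizer.π f g) (congrArg Monad.Algebra.Hom.f w)
      (congrArg Monad.Algebra.Hom.f wF) inferInstance
      (isColimitCoforkMapOfIsColimit S.forget w (coequalizerIsCoequalizer f g))
    exact preservesColimit_of_preserves_colimit_cocone (coequalizerIsCoequalizer f g)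
      ((isColimitMapCoconeCoforkEquiv F w).symm
        (isColimitOfIsColimitCoforkMap S.forget wF l))

lemma action_preserves (A : V) :
    Monad.PreservesColimitOfIsReflexivePair (MonoidalLeftAction.actionLeft S.Module A) :=
  S.preservesColimitOfIsReflexivePair_of_forget _ fun {X Y Z} f g q w w' _ l => by
    have : IsReflexivePair f.f g.f := isReflexivePair_map S.forget f g
    have := (hE.out.action_preserves A).out f.f g.f
    exact ⟨isColimitCoforkMapOfIsColimit (MonoidalLeftAction.actionLeft M A) w l⟩

/-- `Q N` preserves reflexive coequalizers of modules. -/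
def isColimitQl (N : M) {X Y Z : S.Module} (f g : X ⟶ Y) (q : Y ⟶ Z) [IsReflexivePair f g]
    (w : f.f ≫ q.f = g.f ≫ q.f) (l : IsColimit (Cofork.ofπ q.f w))
    (w' : S.Ql N f ≫ S.Ql N q = S.Ql N g ≫ S.Ql N q) :
    IsColimit (Cofork.ofπ (S.Ql N q) w') :=
  have : IsReflexivePair f.f g.f := isReflexivePair_map S.forget f g
  have hq : IsReflexiveQuotient q.f := ⟨_, f.f, g.f, inferInstance, w, ⟨l⟩⟩
  have := (hE.out.tensor_preserves N).out f.f g.f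
  have : Epi (lact S.tensor N q.f) := (S.isReflexiveQuotient_lact hq N).epi
  have : Epi (lact S.tensor N (lact S.tensor S.unit q.f)) :=
    (S.isReflexiveQuotient_lact (S.isReflexiveQuotient_lact hq S.unit) N).epi
  -- Precomposed with `π N Y` it becomes `N * q` followed by `π N Z`, a composite of epimorphisms.
  have : Epi (S.Ql N q) := by
    have := epi_comp (lact S.tensor N q.f) (S.π N Z)
    rw [← S.π_Ql] at this
    exact epi_of_epi (S.π N Y) _
  have lN := isColimitCoforkMapOfIsColimit (S.tensor.obj N) w l
  -- A cofork on the quotients is pulled back along `π N Y`, factored through the coequalizer `N *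
  -- q` as `k`, and then descended along `π N Z`; balancing of `k` is tested on the epimorphism `N *
  -- (R * q)`.
  Cofork.IsColimit.mk' _ fun s => by
    have hk : lact S.tensor N f.f ≫ S.π N Y ≫ s.π = lact S.tensor N g.f ≫ S.π N Y ≫ s.π := by
      rw [← reassoc_of% S.π_Ql, s.condition, reassoc_of% S.π_Ql]
    let k := Cofork.IsColimit.desc lN _ hk
    have hk' : lact S.tensor N q.f ≫ k = S.π N Y ≫ s.π := Cofork.IsColimit.π_desc' lN _ hk
    have hπ : S.Ql N q ≫ desc k (by
        rw [← cancel_epi (lact S.tensor N (lact S.tensor S.unit q.f)),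
          reassoc_of% S.mu_naturality, hk', reassoc_of% S.π_condition,
          reassoc_of% lact_square _ N (S.hom_act q), hk']) = s.π := hom_ext_π (by
      rw [reassoc_of% S.π_Ql, π_desc, hk'])
    exact ⟨_, hπ, fun {m} hm => (cancel_epi (S.Ql N q)).1 (hm.trans hπ.symm)⟩

lemma tensor_preserves (N : S.Module) :
    Monad.PreservesColimitOfIsReflexivePair (S.tensorModule.obj N) :=
  S.preservesColimitOfIsReflexivePair_of_forget _ fun f g q w w' _ l =>
    ⟨S.isColimitQl N.A f g q w l w'⟩

lemma module_isR2Exact : S.moduleActegory.IsR2Exact where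
  hasReflexiveCoequalizers := S.module_hasReflexiveCoequalizers
  action_preserves := S.action_preserves
  tensor_preserves := S.tensor_preserves
  strong A X Y := by
    have : IsIso (S.forget.map (S.moduleActegory.Γ' A X Y)) := S.isIso_ΓQ' A X.A Y
    exact isIso_of_reflects_iso _ S.forget

end Exactness

/-! ### Hom objects of modules. -/

section Tensored

variable {S}

/-- The condition for a morphism out of `A ⊙ X` to be a morphism of modules, in terms of `Γ'`. -/
lemma lact_act_eq_actionAct_iff {A : V} {X Y : S.Module} (f : A ⊙ₗ X.A ⟶ Y.A) :
    lact S.tensor S.unit f ≫ S.act Y = S.act (S.actionObj A X) ≫ f ↔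
      A ⊴ₗ S.act X ≫ f = S.Γ' A S.unit X.A ≫ lact S.tensor S.unit f ≫ S.act Y := by
  rw [← cancel_epi (S.Γ' A S.unit X.A), reassoc_of% S.Γ'_act, eq_comm]

section Hom

variable {X : S.Module} {H H' : M ⥤ V} (adj : MonoidalLeftAction.actionRight V X.A ⊣ H)
  (adj' : MonoidalLeftAction.actionRight V (prod S.tensor S.unit X.A) ⊣ H') (Y : S.Module)

/-- Precomposition with the structure map of `X`, on hom objects. -/
def homSource : H.obj Y.A ⟶ H'.obj Y.A :=
  homCurry adj' _ _ (H.obj Y.A ⊴ₗ S.act X ≫ homEval adj Y.A)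

/-- The action of `R * -` followed by the structure map of `Y`, on hom objects. -/
def homTarget : H.obj Y.A ⟶ H'.obj Y.A :=
  homCurry adj' _ _ (S.Γ' (H.obj Y.A) S.unit X.A ≫
    lact S.tensor S.unit (homEval adj Y.A) ≫ S.act Y)

variable {Y}

/-- Any `f` is evaluation precomposed with `k ⊙ X` for its transpose `k`, so by naturality in `A` it
suffices to transpose both sides of the module condition for evaluation itself; these are
`homSource` and `homTarget`. -/
lemma hom_condition_iff {A : V} (f : A ⊙ₗ X.A ⟶ Y.A) :
    lact S.tensor S.unit f ≫ S.act Y = S.act (S.actionObj A X) ≫ f ↔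
      homCurry adj A Y.A f ≫ homSource adj adj' Y =
        homCurry adj A Y.A f ≫ homTarget adj adj' Y := by
  obtain ⟨k, rfl⟩ : ∃ k : A ⟶ H.obj Y.A, k ⊵ₗ X.A ≫ homEval adj Y.A = f :=
    ⟨homCurry adj A Y.A f, (homCurry adj A Y.A).injective (homCurry_eval adj _)⟩
  rw [lact_act_eq_actionAct_iff, homCurry_eval, homSource, homTarget, ← homCurry_naturality,
    ← homCurry_naturality, (homCurry adj' _ _).apply_eq_iff_eq, lact_comp, Category.assoc,
    ← reassoc_of% S.Γ'_naturality₀, MonoidalLeftAction.action_exchange_assoc]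

variable [HasEqualizers V]

/-- Morphisms of modules out of `A ⊙ X` correspond to morphisms into the hom object, an
equalizer of hom objects of the underlying category. -/
def moduleHomEquiv (A : V) (Y : S.Module) : (S.actionObj A X ⟶ Y) ≃
    (A ⟶ equalizer (homSource adj adj' Y) (homTarget adj adj' Y)) where
  toFun f := equalizer.lift (homCurry adj A Y.A f.f) ((hom_condition_iff adj adj' f.f).1 f.h)
  invFun k := SkewMonoidal.mkHom ((homCurry adj A Y.A).symm (k ≫ equalizer.ι _ _))
    ((hom_condition_iff adj adj' _).2 (by
      rw [Equiv.apply_symm_apply, Category.assoc, Category.assoc, equalizer.condition]))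
  left_inv f := Monad.Algebra.Hom.ext (by
    change (homCurry adj A Y.A).symm (_ ≫ _) = _
    rw [equalizer.lift_ι, Equiv.symm_apply_apply])
  right_inv k := equalizer.hom_ext (by rw [equalizer.lift_ι, Equiv.apply_symm_apply])

end Hom

lemma module_isTensored [HasEqualizers V] (hT : S.IsTensored) : S.moduleActegory.IsTensored :=
  fun X => by
    obtain ⟨H, ⟨adj⟩⟩ := hT X.A
    -- The module condition equates two morphisms out of `A ⊙ (R * X)`, so the parallel pair to be
    -- equalized lands in the hom object out of `R * X`.
    obtain ⟨H', ⟨adj'⟩⟩ := hT (prod S.tensor S.unit X.A)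
    refine ⟨_, ⟨Adjunction.adjunctionOfEquivRight (F := MonoidalLeftAction.actionRight V X)
      (fun A Y => moduleHomEquiv adj adj' A Y) fun A' A Y k f => equalizer.hom_ext ?_⟩⟩
    change equalizer.lift _ _ ≫ _ = (k ≫ equalizer.lift _ _) ≫ _
    rw [Category.assoc, equalizer.lift_ι, equalizer.lift_ι]
    exact homCurry_naturality adj k f.f

end Tensored

end SkewMonoidalActegory

end SkewActegory

end

theorem mainTheorem2
    {V : Type u} [Category.{v} V] [MonoidalCategory V] [SymmetricCategory V] [MonoidalClosed V]
    [HasLimits V] [HasColimits V]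
    {M : Type u₁} [Category.{v₁} M] [MonoidalLeftAction V M]
    (S : SkewActegory.SkewMonoidalActegory V M) (hT : S.IsTensored) (hE : S.IsR2Exact) :
    -- a `V`-action and a skew monoidal `V`-actegory structure on `M^T`, and the structure of a
    -- skew monoidal `V`-functor on the forgetful functor `G : M^T ⥤ M`
    ∃ (_ : MonoidalLeftAction V S.Module)
      (S' : SkewActegory.SkewMonoidalActegory V S.Module)
      (G : SkewActegory.SkewMonoidalVFunctor S' S S.forget),
      S'.IsTensored ∧ S'.IsR2Exact ∧
      SkewActegory.IsStrict S.forget G.strength ∧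
      G.IsStrictlyNormal ∧
      -- the skew unit is the module `(R, ε_R)`
      S'.unit = S.unitModule ∧
      -- the structure map of `A ⊙ (X, α)` is `(A ⊙ α) ∘ Γ'⁻¹`, up to the (identity) strength
      (∀ (A : V) (X : S.Module),
        S.Γ' A S.unit X.A ≫
            SkewActegory.lact S.tensor S.unit (G.strength.μₗ A X) ≫ S.act (A ⊙ₗ X) =
          A ⊴ₗ S.act X ≫ G.strength.μₗ A X) ∧
      -- the multiplicativity constraint of `G` is the coequalizer of `μ_{N,X}` and `N * α`
      (∀ N X : S.Module,
        ∃ w : S.mu N.A X.A ≫ G.F₂ N X = SkewActegory.lact S.tensor N.A (S.act X) ≫ G.F₂ N X,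
          Nonempty (IsColimit (Cofork.ofπ (G.F₂ N X) w))) ∧
      -- the structure map of the tensor product of modules is induced by that of `N`
      (∀ N X : S.Module,
        SkewActegory.lact S.tensor S.unit (G.F₂ N X) ≫
            S.act (SkewActegory.prod S'.tensor N X) =
          S.γ S.unit N.A X.A ≫ SkewActegory.ract S.tensor (S.act N) X.A ≫ G.F₂ N X) := by
  have : Fact S.IsR2Exact := ⟨hE⟩
  refine ⟨inferInstance, S.moduleActegory, S.forgetSkewMonoidalVFunctor,
    SkewActegory.SkewMonoidalActegory.module_isTensored hT, S.module_isR2Exact,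
    fun A X => ⟨rfl, rfl⟩, ⟨rfl, rfl⟩, rfl, fun A X => ?_,
    fun N X => ⟨S.π_condition N.A X, ⟨S.isColimitπ N.A X⟩⟩, S.lact_π_ψ⟩
  -- The strength of the forgetful functor is an identity by construction.
  change S.Γ' A S.unit X.A ≫ SkewActegory.lact S.tensor S.unit (𝟙 (A ⊙ₗ X.A)) ≫ S.actionAct A X =
    A ⊴ₗ S.act X ≫ 𝟙 (A ⊙ₗ X.A)
  rw [SkewActegory.lact_id, Category.id_comp, Category.comp_id, S.Γ'_actionAct]
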